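/- Let $n\ge 2$, let $\Omega\subset\mathbb R^n$ be a bounded domain, $\epsilon>0$, and let $\alpha\ge 0$, $\beta>0$ with $\alpha+\beta=1$. Put $O_\epsilon=\{x\in\mathbb R^n\setminus\Omega : \operatorname{dist}(x,\partial\Omega)\le\epsilon\}$, $\Omega_\epsilon=\Omega\cup O_\epsilon$ and $\Gamma_\epsilon=\{x\in\mathbb R^n:\operatorname{dist}(x,\partial\Omega)\le\epsilon\}$, and let $F:\Gamma_\epsilon\to\mathbb R$ be Lipschitz continuous. Let $\delta(x)=0$ if $x\in\Omega$ and $\operatorname{dist}(x,\partial\Omega)>\epsilon$, $\delta(x)=1-\epsilon^{-1}\operatorname{dist}(x,\partial\Omega)$ if $x\in\Omega$ and $\operatorname{dist}(x,\partial\Omega)\le\epsilon$, and $\delta(x)=1$ if $x\in O_\epsilon$. For $v\in\partial B_\epsilon=\{v:|v|=\epsilon\}$ let $\mu_v$ be the uniform probability measure on the $(n-1)$-dimensional closed disk of radius $\epsilon$ centred at $0$ and orthogonal to $v$. For bounded Borel functions $u:\Omega_\epsilon\to\mathbb R$ let $$Iu(x)=\frac{1-\delta(x)}2\Big[\sup_{v\in\partial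 B_\epsilon}\Big(\alpha u(x+v)+\beta\int u(x+z)\,d\mu_v(z)\Big)+\inf_{v\in\partial B_\epsilon}\Big(\alpha u(x+v)+\beta\int u(x+z)\,d\mu_v(z)\Big)\Big]+\delta(x)F(x),\qquad x\in\Omega_\epsilon,$$ where the first summand is read as $0$ on $O_\epsilon$. Consider the following two-player game started at $x_0\in\Omega_\epsilon$. Whenever the token is at a point $x_k$ ($k\ge 0$), the game ends there with probability $\delta(x_k)$ (in particular surely if $x_k\in O_\epsilon$). If it does not end, both players choose move vectors in $\partial B_\epsilon$ through their strategies, a fair coin selects one of these vectors, $v$, and the token moves to $x_{k+1}=x_k+v$ with probability $\alpha$ and to $x_{k+1}=x_k+z$, with $z$ distributed according to $\mu_v$, with probability $\beta$. If the game ends at $x_\tau$, Player II pays $F(x_\tau)$ to Player I. A strategy of a player is a sequence of Borel maps assigning a vector of $\partial B_\epsilon$ to each history $(x_0,\dots,x_k)$, $k\ge 0$. Let $\mathbf P^{x_0}_{S_{\mathrm I},S_{\mathrm{II}}}$ be the law of the game under strategies $S_{\mathrm I},S_{\mathrm{II}}$, let $\mathbf E^{x_0}_{S_{\mathrm I},S_{\mathrm{II}}}$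 be its expectation, and let $$u_{\mathrm{II}}(x_0)=\inf_{S_{\mathrm{II}}}\sup_{S_{\mathrm I}}\mathbf E^{x_0}_{S_{\mathrm I},S_{\mathrm{II}}}[F(x_\tau)].$$ Then: (i) the limit $\underline u(x)=\lim_{k\to\infty}I^k(\inf F)(x)$ exists in $\mathbb R$ for every $x\in\Omega_\epsilon$, where $\inf F$ stands for the corresponding constant function; (ii) for every $x\in\Omega_\epsilon$ and all strategies $S_{\mathrm I},S_{\mathrm{II}}$, the game ends $\mathbf P^{x}_{S_{\mathrm I},S_{\mathrm{II}}}$-almost surely and $F(x_\tau)$ is integrable, so that $u_{\mathrm{II}}$ is well defined; (iii) $u_{\mathrm{II}}(x)\le\underline u(x)$ for every $x\in\Omega_\epsilon$. -/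

import Mathlib

open MeasureTheory ProbabilityTheory Filter Topology
open scoped ENNReal NNReal

noncomputable section

namespace TugOfWar

/-- Euclidean `n`-space. -/
abbrev E (n : ℕ) : Type := EuclideanSpace ℝ (Fin n)

/-- The sphere `∂B_ε` of admissible (intended) move vectors. -/
abbrev Moves (n : ℕ) (ε : ℝ) : Type := Metric.sphere (0 : E n) ε

/-! ### The uniform measure on the orthogonal disk -/

/-- `μ_v`: the uniform probability measure on the closed `(n-1)`-dimensional disk of radius `ε`
that is orthogonal to `v`, i.e. normalised Lebesgue measure on the ball of radius `ε` of the
hyperplane `v^⊥`, seen as a measure on the whole space. -/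
def diskMeasure {n : ℕ} (ε : ℝ) (v : E n) : Measure (E n) :=
  Measure.map Subtype.val
    (cond (volume : Measure (Submodule.span ℝ {v})ᗮ) (Metric.closedBall 0 ε))

lemma isProbabilityMeasure_diskMeasure {n : ℕ} {ε : ℝ} (hε : 0 < ε) (v : E n) :
    IsProbabilityMeasure (diskMeasure ε v) := by
  have h : IsProbabilityMeasure
      (cond (volume : Measure (Submodule.span ℝ {v})ᗮ) (Metric.closedBall 0 ε)) := by
    refine cond_isProbabilityMeasure_of_finite ?_ ?_
    · exact (Metric.measure_closedBall_pos _ _ hε).ne'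
    · exact measure_closedBall_lt_top.ne
  exact Measure.isProbabilityMeasure_map measurable_subtype_coe.aemeasurable

/-- A linear isometry moving `e` to `v` moves `μ_e` to `μ_v`. -/
lemma diskMeasure_map {n : ℕ} (ε : ℝ) (R : E n ≃ₗᵢ[ℝ] E n) (e : E n) :
    diskMeasure ε (R e) = Measure.map R (diskMeasure ε e) := by
  have hmap : (Submodule.span ℝ {e})ᗮ.map (R.toLinearEquiv : E n →ₗ[ℝ] E n)
      = (Submodule.span ℝ {R e})ᗮ := by
    have h := Submodule.map_orthogonal_equiv (Submodule.span ℝ {e}) R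
    rw [Submodule.map_span, Set.image_singleton] at h
    exact h
  let f : (Submodule.span ℝ {e})ᗮ ≃ₗᵢ[ℝ] (Submodule.span ℝ {R e})ᗮ :=
    (R.submoduleMap (Submodule.span ℝ {e})ᗮ).trans (LinearIsometryEquiv.ofEq _ _ hmap)
  have hf : ∀ x, ((f x : (Submodule.span ℝ {R e})ᗮ) : E n) = R x := fun x => rfl
  have hmp : MeasurePreserving f volume volume := f.measurePreserving
  have hpre : f ⁻¹' (Metric.closedBall 0 ε) = Metric.closedBall 0 ε := by
    ext x
    simp
  have hcond : cond (volume : Measure (Submodule.span ℝ {R e})ᗮ) (Metric.closedBall 0 ε)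
      = Measure.map f
        (cond (volume : Measure (Submodule.span ℝ {e})ᗮ) (Metric.closedBall 0 ε)) := by
    have hr := (hmp.restrict_preimage
      (s := Metric.closedBall 0 ε) measurableSet_closedBall).map_eq
    rw [hpre] at hr
    have hv := hmp.measure_preimage
      (s := Metric.closedBall 0 ε) measurableSet_closedBall.nullMeasurableSet
    rw [hpre] at hv
    unfold ProbabilityTheory.cond
    rw [Measure.map_smul, hr, hv]
  unfold diskMeasure
  rw [hcond, Measure.map_map measurable_subtype_coe hmp.measurable,
    Measure.map_map R.continuous.measurable measurable_subtype_coe]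
  rfl

lemma measurable_diskMeasure {n : ℕ} {ε : ℝ} (hε : 0 < ε) :
    Measurable fun v : Moves n ε => diskMeasure ε (v : E n) := by
  rcases isEmpty_or_nonempty (Moves n ε) with hemp | ⟨⟨e⟩⟩
  · exact measurable_of_empty _
  have hkey : ∀ v : Moves n ε, diskMeasure ε (v : E n)
      = Measure.map ((Submodule.span ℝ {(e : E n) - v})ᗮ.reflection) (diskMeasure ε (e : E n)) := by
    intro v
    have hnorm : ‖(e : E n)‖ = ‖(v : E n)‖ := by
      rw [mem_sphere_zero_iff_norm.mp e.2, mem_sphere_zero_iff_norm.mp v.2]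
    rw [← diskMeasure_map, Submodule.reflection_sub hnorm]
  have hform : ∀ (v : Moves n ε) (z : E n), (Submodule.span ℝ {(e : E n) - v})ᗮ.reflection z
      = z - (2 * (inner ℝ ((e : E n) - v) z / ‖(e : E n) - v‖ ^ 2)) • ((e : E n) - v) := by
    intro v z
    rw [Submodule.reflection_orthogonal_apply, Submodule.reflection_singleton_apply]
    simp only [RCLike.ofReal_real_eq_id, id_eq]
    rw [mul_smul, two_smul, two_smul, neg_sub]
  have hmeas : Measurable fun p : Moves n ε × E n =>
      (Submodule.span ℝ {(e : E n) - p.1})ᗮ.reflection p.2 := by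
    simp_rw [hform]
    fun_prop
  have := isProbabilityMeasure_diskMeasure hε (e : E n)
  refine Measure.measurable_of_measurable_coe _ fun s hs => ?_
  have := measurable_measure_prodMk_left (ν := diskMeasure ε (e : E n)) (hmeas hs)
  convert this using 2 with v
  rw [hkey v, Measure.map_apply (LinearIsometryEquiv.continuous _).measurable hs]
  rfl

/-- `v ↦ μ_v` as a probability kernel. -/
def diskKernel (n : ℕ) {ε : ℝ} (hε : 0 < ε) : Kernel (Moves n ε) (E n) where
  toFun v := diskMeasure ε (v : E n)
  measurable' := measurable_diskMeasure hε

instance {n : ℕ} {ε : ℝ} (hε : 0 < ε) : IsMarkovKernel (diskKernel n hε) :=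
  ⟨fun v => isProbabilityMeasure_diskMeasure hε (v : E n)⟩

/-! ### The setting -/

/-- The data of the problem: a bounded domain `Ω`, a step size `ε`, weights `α ≥ 0`, `β > 0` with
`α + β = 1`, and Lipschitz boundary values `F` on the strip
`Γ_ε = {x | dist (x, ∂Ω) ≤ ε}` (the values of `F` off the strip are never used). -/
structure Setting (n : ℕ) where
  Ω : Set (E n)
  isOpen : IsOpen Ω
  isConnected : IsConnected Ω
  isBounded : Bornology.IsBounded Ω
  ε : ℝ
  ε_pos : 0 < ε
  α : ℝ
  β : ℝ
  α_nonneg : 0 ≤ α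
  β_pos : 0 < β
  α_add_β : α + β = 1
  F : E n → ℝ
  lipschitz : ∃ K : ℝ≥0, LipschitzOnWith K F {x | Metric.infDist x (frontier Ω) ≤ ε}

namespace Setting

variable {n : ℕ} (G : Setting n)

/-- The boundary strip `Γ_ε`, the domain of the boundary data. -/
def strip : Set (E n) := {x | Metric.infDist x (frontier G.Ω) ≤ G.ε}

/-- The outside boundary strip `O_ε`. -/
def outerStrip : Set (E n) := {x | x ∉ G.Ω ∧ Metric.infDist x (frontier G.Ω) ≤ G.ε}

/-- The thickened domain `Ω_ε = Ω ∪ O_ε`. -/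
def thickened : Set (E n) := G.Ω ∪ G.outerStrip

open Classical in
/-- The cutoff function `δ`: it is `0` in `Ω` at distance more than `ε` from `∂Ω`,
`1 - dist (x, ∂Ω) / ε` in the rest of `Ω`, and `1` outside of `Ω`. -/
def δ (x : E n) : ℝ :=
  if x ∈ G.Ω then
    if Metric.infDist x (frontier G.Ω) ≤ G.ε then 1 - G.ε⁻¹ * Metric.infDist x (frontier G.Ω)
    else 0
  else 1

/-- `α u(x + v) + β ∫ u(x + z) dμ_v(z)`. -/
def W (u : E n → ℝ) (x : E n) (v : Moves n G.ε) : ℝ :=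
  G.α * u (x + v) + G.β * ∫ z, u (x + z) ∂(diskMeasure G.ε (v : E n))

/-- The operator `I` of the dynamic programming principle. A function on `Ω_ε` is represented by
a function on the whole space; the values of `I u` on `Ω_ε` depend only on those of `u` on `Ω_ε`. -/
def op (u : E n → ℝ) (x : E n) : ℝ :=
  (1 - G.δ x) / 2 * ((⨆ v, G.W u x v) + ⨅ v, G.W u x v) + G.δ x * G.F x

/-- The iterates `u_k = I^k (inf F)`. -/
def iter (k : ℕ) : E n → ℝ := G.op^[k] fun _ => sInf (G.F '' G.strip)

/-- The function `u̲ = lim_k I^k (inf F)` on `Ω_ε`. -/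
def lowerSol (x : E n) : ℝ := limUnder atTop fun k => G.iter k x

/-! ### The game -/

/-- A strategy: for every `k`, a Borel map taking the history `(x_0, …, x_k)` of token positions
to a move vector in `∂B_ε`. (The token never leaves the closed set `Ω_ε`, so only the values on
histories in `Ω_ε` matter, and every Borel map on these histories extends to all of them.) -/
def Strategy : Type :=
  {S : (k : ℕ) → (Finset.Iic k → E n) → Moves n G.ε // ∀ k, Measurable (S k)}

/-- The law of the next position when the token is at `x` and the winner of the coin toss
intends to move by `v`: `x + v` with probability `α`, and `x + z` with `z` distributed according
to `μ_v` with probability `β`. -/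
def moveKernel : Kernel (E n × Moves n G.ε) (E n) where
  toFun p := ENNReal.ofReal G.α • Measure.dirac (p.1 + (p.2 : E n)) +
    ENNReal.ofReal G.β • Measure.map (fun z => p.1 + z) (diskMeasure G.ε (p.2 : E n))
  measurable' := by
    refine Measure.measurable_of_measurable_coe _ fun s hs => ?_
    have h1 : Measurable fun p : E n × Moves n G.ε =>
        Measure.dirac (p.1 + (p.2 : E n)) s := by
      have hd : Measurable fun p : E n × Moves n G.ε => Measure.dirac (p.1 + (p.2 : E n)) :=
        Measure.measurable_dirac.comp (by fun_prop)
      exact (Measure.measurable_coe hs).comp hd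
    have h2 : Measurable fun p : E n × Moves n G.ε =>
        Measure.map (fun z => p.1 + z) (diskMeasure G.ε (p.2 : E n)) s := by
      have hm : Measurable fun q : (E n × Moves n G.ε) × E n => q.1.1 + q.2 := by fun_prop
      have := Kernel.measurable_kernel_prodMk_left
        (κ := (diskKernel n G.ε_pos).comap (Prod.snd : E n × Moves n G.ε → _) measurable_snd)
        (hm hs)
      convert this using 2 with p
      rw [Measure.map_apply (by fun_prop) hs]
      rfl
    simp only [Measure.coe_add, Measure.coe_smul, Pi.add_apply, Pi.smul_apply, smul_eq_mul]
    exact (h1.const_mul _).add (h2.const_mul _)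

instance : IsMarkovKernel G.moveKernel := ⟨fun p => ⟨by
  have := isProbabilityMeasure_diskMeasure G.ε_pos (p.2 : E n)
  have h : IsProbabilityMeasure
      (Measure.map (fun z => p.1 + z) (diskMeasure G.ε (p.2 : E n))) :=
    Measure.isProbabilityMeasure_map (by fun_prop)
  change (ENNReal.ofReal G.α • Measure.dirac (p.1 + (p.2 : E n)) +
    ENNReal.ofReal G.β • Measure.map (fun z => p.1 + z) (diskMeasure G.ε (p.2 : E n)))
      Set.univ = 1
  simp only [Measure.coe_add, Measure.coe_smul, Pi.add_apply, Pi.smul_apply, smul_eq_mul,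
    measure_univ, mul_one]
  rw [← ENNReal.ofReal_add G.α_nonneg G.β_pos.le, G.α_add_β, ENNReal.ofReal_one]⟩⟩

/-- A state of the game: the position of the token, and whether the game has ended there. -/
abbrev State (n : ℕ) : Type := E n × Bool

lemma measurable_δ : Measurable G.δ := by
  classical
  unfold δ
  refine Measurable.ite G.isOpen.measurableSet (Measurable.ite ?_ ?_ measurable_const)
    measurable_const
  · exact measurableSet_le (Metric.continuous_infDist_pt _).measurable measurable_const
  · exact measurable_const.sub
      (measurable_const.mul (Metric.continuous_infDist_pt _).measurable)

lemma δ_nonneg (x : E n) : 0 ≤ G.δ x := by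
  unfold δ
  split_ifs with h1 h2
  · have := mul_le_mul_of_nonneg_left h2 (inv_nonneg.mpr G.ε_pos.le)
    rw [inv_mul_cancel₀ G.ε_pos.ne'] at this
    linarith
  · exact le_rfl
  · exact zero_le_one

lemma δ_le_one (x : E n) : G.δ x ≤ 1 := by
  unfold δ
  split_ifs with h1 h2
  · have := mul_nonneg (inv_nonneg.mpr G.ε_pos.le)
      (Metric.infDist_nonneg (x := x) (s := frontier G.Ω))
    linarith
  · exact zero_le_one
  · exact le_rfl

/-- The lottery deciding about the end of the game when the token has arrived at `x`: the game
ends there with probability `δ(x)` (so surely if `x` lies outside of `Ω`). -/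
def endKernel : Kernel (E n) (State n) where
  toFun x := ENNReal.ofReal (G.δ x) • Measure.dirac (x, true) +
    ENNReal.ofReal (1 - G.δ x) • Measure.dirac (x, false)
  measurable' := by
    refine Measure.measurable_of_measurable_coe _ fun s hs => ?_
    have h : ∀ b : Bool, Measurable fun x : E n => Measure.dirac ((x, b) : State n) s := by
      intro b
      have hd : Measurable fun x : E n => Measure.dirac ((x, b) : State n) :=
        Measure.measurable_dirac.comp (by fun_prop)
      exact (Measure.measurable_coe hs).comp hd
    simp only [Measure.coe_add, Measure.coe_smul, Pi.add_apply, Pi.smul_apply, smul_eq_mul]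
    exact (G.measurable_δ.ennreal_ofReal.mul (h true)).add
      ((measurable_const.sub G.measurable_δ).ennreal_ofReal.mul (h false))

instance : IsMarkovKernel G.endKernel := ⟨fun x => ⟨by
  change (ENNReal.ofReal (G.δ x) • Measure.dirac ((x, true) : State n) +
    ENNReal.ofReal (1 - G.δ x) • Measure.dirac ((x, false) : State n)) Set.univ = 1
  simp only [Measure.coe_add, Measure.coe_smul, Pi.add_apply, Pi.smul_apply, smul_eq_mul,
    measure_univ, mul_one]
  rw [← ENNReal.ofReal_add (G.δ_nonneg x) (sub_nonneg.mpr (G.δ_le_one x)),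
    add_sub_cancel, ENNReal.ofReal_one]⟩⟩

/-- The history of token positions underlying a history of states. -/
def positions {n : ℕ} (k : ℕ) (h : Finset.Iic k → State n) : Finset.Iic k → E n :=
  fun i => (h i).1

/-- The last state of a history. -/
def last {n : ℕ} (k : ℕ) (h : Finset.Iic k → State n) : State n :=
  h ⟨k, Finset.mem_Iic.mpr le_rfl⟩

lemma measurable_last {n : ℕ} (k : ℕ) : Measurable (last (n := n) k) :=
  measurable_pi_apply _

lemma measurable_positions {n : ℕ} (k : ℕ) : Measurable (positions (n := n) k) :=
  measurable_pi_lambda _ fun i => measurable_fst.comp (measurable_pi_apply i)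

/-- The move of a player with strategy `S` who has won the coin toss of the given turn. -/
def playerKernel (S : G.Strategy) (k : ℕ) : Kernel (Finset.Iic k → State n) (E n) :=
  G.moveKernel.comap (fun h => ((last k h).1, S.1 k (positions k h)))
    ((measurable_fst.comp (measurable_last k)).prodMk
      ((S.2 k).comp (measurable_positions k)))

instance (S : G.Strategy) (k : ℕ) : IsMarkovKernel (G.playerKernel S k) := by
  unfold playerKernel
  infer_instance

/-- The fair coin toss between the two players, followed by the move of the winner. -/
def coinKernel (SI SII : G.Strategy) (k : ℕ) : Kernel (Finset.Iic k → State n) (E n) where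
  toFun h := (2⁻¹ : ℝ≥0∞) • G.playerKernel SI k h + (2⁻¹ : ℝ≥0∞) • G.playerKernel SII k h
  measurable' := by
    refine Measure.measurable_of_measurable_coe _ fun s hs => ?_
    simp only [Measure.coe_add, Measure.coe_smul, Pi.add_apply, Pi.smul_apply, smul_eq_mul]
    exact ((Kernel.measurable_coe _ hs).const_mul _).add
      ((Kernel.measurable_coe _ hs).const_mul _)

instance (SI SII : G.Strategy) (k : ℕ) : IsMarkovKernel (G.coinKernel SI SII k) :=
  ⟨fun h => ⟨by
    change ((2⁻¹ : ℝ≥0∞) • G.playerKernel SI k h +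
      (2⁻¹ : ℝ≥0∞) • G.playerKernel SII k h) Set.univ = 1
    simp only [Measure.coe_add, Measure.coe_smul, Pi.add_apply, Pi.smul_apply, smul_eq_mul,
      measure_univ, mul_one]
    exact ENNReal.inv_two_add_inv_two⟩⟩

lemma measurableSet_ended {n : ℕ} (k : ℕ) :
    MeasurableSet {h : Finset.Iic k → State n | (last k h).2 = true} :=
  (measurable_snd.comp (measurable_last k)) (measurableSet_singleton true)

open Classical in
/-- One turn of the game: nothing changes any more if the game has ended; otherwise the coin is
tossed, the token is moved, and the end-of-game lottery takes place at the new position. -/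
def turnKernel (SI SII : G.Strategy) (k : ℕ) : Kernel (Finset.Iic k → State n) (State n) :=
  Kernel.piecewise (measurableSet_ended k)
    (Kernel.deterministic (last k) (measurable_last k))
    (G.endKernel ∘ₖ G.coinKernel SI SII k)

instance (SI SII : G.Strategy) (k : ℕ) : IsMarkovKernel (G.turnKernel SI SII k) := by
  unfold turnKernel
  infer_instance

/-- The law `P^{x}_{S_I, S_II}` of the trajectory of the game started at `x`. -/
def law (SI SII : G.Strategy) (x : E n) : Measure (ℕ → State n) :=
  Kernel.trajMeasure (X := fun _ => State n) (G.endKernel x) (G.turnKernel SI SII)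

/-- The time `τ` at which the game ends (for trajectories along which it does end). -/
def endTime {n : ℕ} (ω : ℕ → State n) : ℕ := sInf {k | (ω k).2 = true}

/-- The amount `F(x_τ)` which Player II pays to Player I. -/
def payoff (ω : ℕ → State n) : ℝ := G.F (ω (endTime ω)).1

/-- `u_II(x)`, the value of the game for Player II:
`inf_{S_II} sup_{S_I} E^{x}_{S_I, S_II}[F(x_τ)]`, taken in the extended reals. -/
def valueII (x : E n) : EReal :=
  ⨅ SII : G.Strategy, ⨆ SI : G.Strategy, ((∫ ω, G.payoff ω ∂(G.law SI SII x) : ℝ) : EReal)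

end Setting

end TugOfWar

end

/-! Everything rests on one Lyapunov function. Since `n ≥ 2` and `β > 0`, the random part of a move
spreads the token in a hyperplane of dimension at least one, so a steep exponential `exp (l * ‖x‖ ^
2)` at least doubles on average under every intended move (`two_mul_exp_le_W`). A constant minus
this exponential is a bounded `ψ` that loses at least `1` per turn, whatever the players do
(`exists_lyapunov`). As `ψ ≤ K`, this loss is also a factor `1 - K⁻¹`.

The function `ψ` is used three times. It makes the survival probability decay geometrically, so the
game ends almost surely (`measureReal_not_ended_le`). It makes `I` a contraction in a weighted
sense, so the increasing iterates `u_k` have uniformly geometric increments (`dpp_iterate_succ_le`).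
It also pays for the errors of Player II in the comparison with the value.

For that comparison, fix a small `η` and take `N` with `u_{N+1} ≤ u_N + η` on `Ω_ε`. Player II
always plays an `η`-minimizer of the average of `u_N`. Let the potential be `F` at ended states and
`mid u_N + 2ηψ` at running ones: its expectation never increases, starts below `u_{N+1}(x) + 2ηK`,
and tends to the expected payoff (`valueII_le_dpp_add`). Using the finite iterate `u_N` instead of
the limit keeps all functions continuous, so the minimizer can be chosen Borel. The continuity comes
from extending `F` off the strip (`exists_extension`), from the continuity of `δ`, and from the
joint continuity of the averages. -/

noncomputable section

namespace TugOfWar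

/-! ### Moments of the disk measure -/

section Disk

variable {n : ℕ} {ε : ℝ}

lemma ae_diskMeasure_iff {v : E n} {p : E n → Prop} (hp : MeasurableSet {z | p z}) :
    (∀ᵐ z ∂(diskMeasure ε v), p z) ↔
      ∀ᵐ z : (Submodule.span ℝ {v})ᗮ ∂volume, z ∈ Metric.closedBall 0 ε → p z := by
  unfold diskMeasure
  rw [ae_map_iff measurable_subtype_coe.aemeasurable hp, ProbabilityTheory.cond,
    Measure.ae_ennreal_smul_measure_iff, ae_restrict_iff' measurableSet_closedBall]
  exact ENNReal.inv_ne_zero.mpr measure_closedBall_lt_top.ne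

lemma ae_norm_le_diskMeasure (v : E n) : ∀ᵐ z ∂(diskMeasure ε v), ‖z‖ ≤ ε := by
  rw [ae_diskMeasure_iff (measurableSet_le measurable_norm measurable_const)]
  filter_upwards with z hz
  simpa using hz

lemma integrable_diskMeasure (hε : 0 < ε) (v : E n) {f : E n → ℝ} (hf : Continuous f) :
    Integrable f (diskMeasure ε v) := by
  have := isProbabilityMeasure_diskMeasure hε v
  obtain ⟨C, hC⟩ := (isCompact_closedBall (0 : E n) ε).exists_bound_of_continuousOn hf.continuousOn
  refine Integrable.of_bound hf.aestronglyMeasurable C ?_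
  filter_upwards [ae_norm_le_diskMeasure v] with z hz
  exact hC z (by simpa using hz)

/-- The disk is symmetric under `z ↦ -z`, so odd functions integrate to zero; orthogonality to `v`
plays no role. -/
lemma integral_inner_diskMeasure (x v : E n) :
    ∫ z, inner ℝ x z ∂(diskMeasure ε v) = 0 := by
  have hneg : diskMeasure ε (-v) = diskMeasure ε v := by
    have h : Submodule.span ℝ {-v} = Submodule.span ℝ {v} := by
      rw [← Set.neg_singleton, Submodule.span_neg]
    -- The measure lives on a type depending on the subspace, so the equality of spans is used by
    -- substitution rather than rewriting.
    have key : ∀ K L : Submodule ℝ (E n), K = L →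
        Measure.map Subtype.val (cond (volume : Measure Kᗮ) (Metric.closedBall 0 ε)) =
        Measure.map Subtype.val (cond (volume : Measure Lᗮ) (Metric.closedBall 0 ε)) := by
      rintro K _ rfl
      rfl
    exact key _ _ h
  have h := diskMeasure_map ε (LinearIsometryEquiv.neg ℝ) v
  rw [LinearIsometryEquiv.coe_neg, hneg] at h
  have h2 : ∫ z, inner ℝ x z ∂(diskMeasure ε v) = -∫ z, inner ℝ x z ∂(diskMeasure ε v) := by
    conv_lhs => rw [h]
    rw [integral_map (by fun_prop) (Continuous.aestronglyMeasurable (by fun_prop)),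
      ← integral_neg]
    simp
  linarith

/-- A vanishing second moment would force `μ_v` to be the Dirac mass at `0`. The hyperplane has
dimension at least `n - 1 ≥ 1`, so its Lebesgue measure has no atoms. -/
lemma integral_norm_sq_diskMeasure_pos (hn : 2 ≤ n) (hε : 0 < ε) (v : E n) :
    0 < ∫ z, ‖z‖ ^ 2 ∂(diskMeasure ε v) := by
  have hint : Integrable (fun z : E n => ‖z‖ ^ 2) (diskMeasure ε v) :=
    integrable_diskMeasure hε v (by fun_prop)
  refine lt_of_le_of_ne (integral_nonneg fun z => by positivity) fun h0 => ?_
  have h1 := (integral_eq_zero_iff_of_nonneg (fun z => by positivity) hint).mp h0.symm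
  have h2 : ∀ᵐ z ∂(diskMeasure ε v), z = 0 := by
    filter_upwards [h1] with z hz
    simpa using hz
  rw [ae_diskMeasure_iff (p := fun z => z = 0) (measurableSet_singleton 0)] at h2
  have hrank : 0 < Module.finrank ℝ (Submodule.span ℝ {v})ᗮ := by
    have h3 := Submodule.finrank_add_finrank_orthogonal (Submodule.span ℝ {v})
    have h4 := finrank_span_le_card (R := ℝ) ({v} : Set (E n))
    rw [Set.toFinset_singleton, Finset.card_singleton] at h4
    have h5 : Module.finrank ℝ (E n) = n := finrank_euclideanSpace_fin
    omega
  have : Nontrivial (Submodule.span ℝ {v})ᗮ := Module.nontrivial_of_finrank_pos hrank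
  have h3 : ∀ᵐ z : (Submodule.span ℝ {v})ᗮ ∂volume, z ≠ 0 := by
    rw [ae_iff]
    simp
  have h4 : ∀ᵐ z : (Submodule.span ℝ {v})ᗮ ∂volume, z ∉ Metric.closedBall 0 ε := by
    filter_upwards [h2, h3] with z hz hz0 hmem
    exact hz0 (Subtype.ext (hz hmem))
  rw [ae_iff] at h4
  simp only [not_not] at h4
  exact (Metric.measure_closedBall_pos volume (0 : (Submodule.span ℝ {v})ᗮ) hε).ne' h4

/-- The reflection that exchanges `e` and `v` when they have the same norm. -/
def swapReflection (e v : E n) : E n ≃ₗᵢ[ℝ] E n := (Submodule.span ℝ {e - v})ᗮ.reflection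

lemma diskMeasure_eq_map_swapReflection {e v : E n} (h : ‖e‖ = ‖v‖) :
    diskMeasure ε v = Measure.map (swapReflection e v) (diskMeasure ε e) := by
  rw [← diskMeasure_map, swapReflection, Submodule.reflection_sub h]

lemma swapReflection_apply (e v z : E n) :
    swapReflection e v z = z - (2 * (inner ℝ (e - v) z / ‖e - v‖ ^ 2)) • (e - v) := by
  rw [swapReflection, Submodule.reflection_orthogonal_apply, Submodule.reflection_singleton_apply]
  simp only [RCLike.ofReal_real_eq_id, id_eq]
  rw [mul_smul, two_smul, two_smul, neg_sub]

lemma integral_diskMeasure_eq {e v : E n} (h : ‖e‖ = ‖v‖) {f : E n → ℝ} (hf : Continuous f) :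
    ∫ z, f z ∂(diskMeasure ε v) = ∫ z, f (swapReflection e v z) ∂(diskMeasure ε e) := by
  rw [diskMeasure_eq_map_swapReflection h,
    integral_map (LinearIsometryEquiv.continuous _).aemeasurable hf.aestronglyMeasurable]

lemma integral_norm_sq_diskMeasure_eq {e v : E n} (h : ‖e‖ = ‖v‖) :
    ∫ z, ‖z‖ ^ 2 ∂(diskMeasure ε v) = ∫ z, ‖z‖ ^ 2 ∂(diskMeasure ε e) := by
  rw [integral_diskMeasure_eq h (by fun_prop)]
  simp

lemma continuous_integral_diskMeasure (hε : 0 < ε) {u : E n → ℝ} (hu : Continuous u) {C : ℝ}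
    (hC : ∀ x, |u x| ≤ C) :
    Continuous fun p : E n × Moves n ε => ∫ z, u (p.1 + z) ∂(diskMeasure ε (p.2 : E n)) := by
  rw [continuous_iff_continuousAt]
  rintro ⟨x, w⟩
  -- All measures near `w` are written as images of one fixed measure under reflections. The
  -- reflection exchanging `e` and `v` is singular at `v = e`, so the base point is `-w`, as far
  -- from `w` as possible; dominated convergence then applies.
  have hnorm : ∀ v : Moves n ε, ‖-(w : E n)‖ = ‖(v : E n)‖ := fun v => by
    rw [norm_neg, mem_sphere_zero_iff_norm.mp w.2, mem_sphere_zero_iff_norm.mp v.2]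
  have hform : (fun p : E n × Moves n ε => ∫ z, u (p.1 + z) ∂(diskMeasure ε (p.2 : E n)))
      = fun p => ∫ z, u (p.1 + swapReflection (-(w : E n)) p.2 z)
          ∂(diskMeasure ε (-(w : E n))) := by
    funext p
    exact integral_diskMeasure_eq (hnorm p.2) (f := fun z => u (p.1 + z)) (by fun_prop)
  rw [hform]
  have := isProbabilityMeasure_diskMeasure hε (-(w : E n))
  refine continuousAt_of_dominated (bound := fun _ => C) ?_ ?_ (integrable_const _) ?_
  · refine Eventually.of_forall fun p => Continuous.aestronglyMeasurable ?_
    have := (swapReflection (-(w : E n)) p.2).continuous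
    fun_prop
  · exact Eventually.of_forall fun p => ae_of_all _ fun z => hC _
  · refine ae_of_all _ fun z => ?_
    have hne : ‖-(w : E n) - w‖ ^ 2 ≠ 0 := by
      have h1 : ‖(w : E n)‖ = ε := mem_sphere_zero_iff_norm.mp w.2
      have h2 : -(w : E n) - w = -((2 : ℝ) • (w : E n)) := by rw [two_smul]; abel
      rw [h2, norm_neg, norm_smul, h1]
      have : (0 : ℝ) < ‖(2 : ℝ)‖ := by norm_num
      positivity
    have hr : ContinuousAt (fun p : E n × Moves n ε =>
        p.1 + swapReflection (-(w : E n)) p.2 z) (x, w) := by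
      simp only [swapReflection_apply]
      have hd : ContinuousAt (fun p : E n × Moves n ε => 2 * (inner ℝ (-(w : E n) - p.2) z /
          ‖-(w : E n) - p.2‖ ^ 2)) (x, w) :=
        continuousAt_const.mul (ContinuousAt.div (Continuous.continuousAt (by fun_prop))
          (Continuous.continuousAt (by fun_prop)) hne)
      exact continuousAt_fst.add (continuousAt_const.sub
        (hd.smul (Continuous.continuousAt (by fun_prop))))
    exact ContinuousAt.comp (f := fun p : E n × Moves n ε =>
        p.1 + swapReflection (-(w : E n)) p.2 z) hu.continuousAt hr

end Disk

namespace Setting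

variable {n : ℕ} (G : Setting n)

lemma nonempty_moves (hn : 2 ≤ n) : Nonempty (Moves n G.ε) := by
  have : Nontrivial (E n) :=
    Module.nontrivial_of_finrank_pos (R := ℝ) (by rw [finrank_euclideanSpace_fin]; omega)
  exact (NormedSpace.sphere_nonempty.mpr G.ε_pos.le).to_subtype

lemma norm_move (v : Moves n G.ε) : ‖(v : E n)‖ = G.ε := mem_sphere_zero_iff_norm.mp v.2

/-! ### The averages `W` -/

lemma continuous_W {u : E n → ℝ} (hu : Continuous u) {C : ℝ} (hC : ∀ x, |u x| ≤ C) :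
    Continuous fun p : E n × Moves n G.ε => G.W u p.1 p.2 := by
  unfold W
  exact (continuous_const.mul (by fun_prop)).add
    (continuous_const.mul (continuous_integral_diskMeasure G.ε_pos hu hC))

/-- `W` only sees the values of `u` in the closed ball of radius `ε`. -/
lemma W_congr {u w : E n → ℝ} {x : E n} (h : ∀ z, ‖z‖ ≤ G.ε → u (x + z) = w (x + z))
    (v : Moves n G.ε) : G.W u x v = G.W w x v := by
  unfold W
  rw [h v (G.norm_move v).le]
  congr 2
  refine integral_congr_ae ?_
  filter_upwards [ae_norm_le_diskMeasure (v : E n)] with z hz using h z hz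

lemma W_mono {u w : E n → ℝ} (hu : Continuous u) (hw : Continuous w) {x : E n}
    (h : ∀ z, ‖z‖ ≤ G.ε → u (x + z) ≤ w (x + z)) (v : Moves n G.ε) :
    G.W u x v ≤ G.W w x v := by
  unfold W
  refine add_le_add (mul_le_mul_of_nonneg_left (h v (G.norm_move v).le) G.α_nonneg)
    (mul_le_mul_of_nonneg_left ?_ G.β_pos.le)
  refine integral_mono_ae (integrable_diskMeasure G.ε_pos _ (by fun_prop))
    (integrable_diskMeasure G.ε_pos _ (by fun_prop)) ?_
  filter_upwards [ae_norm_le_diskMeasure (v : E n)] with z hz using h z hz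

lemma W_add_mul {u w : E n → ℝ} (hu : Continuous u) (hw : Continuous w) (a b : ℝ) (x : E n)
    (v : Moves n G.ε) :
    G.W (fun y => u y + a * w y + b) x v = G.W u x v + a * G.W w x v + b := by
  have := isProbabilityMeasure_diskMeasure G.ε_pos (v : E n)
  have h1 : Integrable (fun z => u (x + z)) (diskMeasure G.ε (v : E n)) :=
    integrable_diskMeasure G.ε_pos _ (by fun_prop)
  have h2 : Integrable (fun z => a * w (x + z)) (diskMeasure G.ε (v : E n)) :=
    integrable_diskMeasure G.ε_pos _ (by fun_prop)
  have h3 : ∫ z, (u (x + z) + a * w (x + z) + b) ∂(diskMeasure G.ε (v : E n))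
      = ∫ z, u (x + z) ∂(diskMeasure G.ε (v : E n))
        + a * ∫ z, w (x + z) ∂(diskMeasure G.ε (v : E n)) + b := by
    have h12 : Integrable (fun z => u (x + z) + a * w (x + z)) (diskMeasure G.ε (v : E n)) :=
      h1.add h2
    rw [integral_add h12 (integrable_const b), integral_add h1 h2, integral_const_mul]
    simp
  unfold W
  rw [h3]
  have hb : b = (G.α + G.β) * b := by rw [G.α_add_β, one_mul]
  linear_combination -hb

lemma W_const (c : ℝ) (x : E n) (v : Moves n G.ε) : G.W (fun _ => c) x v = c := by
  have := G.W_add_mul (u := fun _ => 0) (w := fun _ => 0) continuous_const continuous_const 0 c x v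
  simpa [W] using this

lemma abs_W_le {u : E n → ℝ} (hu : Continuous u) {C : ℝ} (hC : ∀ x, |u x| ≤ C) (x : E n)
    (v : Moves n G.ε) : |G.W u x v| ≤ C := by
  rw [abs_le]
  constructor
  · rw [← G.W_const (-C) x v]
    exact G.W_mono continuous_const hu (fun z _ => (abs_le.mp (hC _)).1) v
  · rw [← G.W_const C x v]
    exact G.W_mono hu continuous_const (fun z _ => (abs_le.mp (hC _)).2) v

lemma bddAbove_W {u : E n → ℝ} (hu : Continuous u) {C : ℝ} (hC : ∀ x, |u x| ≤ C) (x : E n) :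
    BddAbove (Set.range (G.W u x)) :=
  ⟨C, by rintro _ ⟨v, rfl⟩; exact (abs_le.mp (G.abs_W_le hu hC x v)).2⟩

lemma bddBelow_W {u : E n → ℝ} (hu : Continuous u) {C : ℝ} (hC : ∀ x, |u x| ≤ C) (x : E n) :
    BddBelow (Set.range (G.W u x)) :=
  ⟨-C, by rintro _ ⟨v, rfl⟩; exact (abs_le.mp (G.abs_W_le hu hC x v)).1⟩

/-- The tug-of-war average `½ (sup_v W + inf_v W)`. -/
def mid (u : E n → ℝ) (x : E n) : ℝ := ((⨆ v, G.W u x v) + ⨅ v, G.W u x v) / 2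

lemma continuous_mid {u : E n → ℝ} (hu : Continuous u) {C : ℝ} (hC : ∀ x, |u x| ≤ C) :
    Continuous (G.mid u) := by
  have h1 := (isCompact_univ (X := Moves n G.ε)).continuous_sSup (f := G.W u) (G.continuous_W hu hC)
  have h2 := (isCompact_univ (X := Moves n G.ε)).continuous_sInf (f := G.W u) (G.continuous_W hu hC)
  simp only [Set.image_univ] at h1 h2
  exact (h1.add h2).div_const 2

lemma mid_le_mid_add [Nonempty (Moves n G.ε)] {u w : E n → ℝ} (hu : Continuous u)
    (hw : Continuous w) {C : ℝ} (hCu : ∀ x, |u x| ≤ C) (hCw : ∀ x, |w x| ≤ C) {x : E n} {a : ℝ}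
    (h : ∀ v, G.W u x v ≤ G.W w x v + a) : G.mid u x ≤ G.mid w x + a := by
  have h1 : (⨆ v, G.W u x v) ≤ (⨆ v, G.W w x v) + a :=
    ciSup_le fun v => (h v).trans (add_le_add_left (le_ciSup (G.bddAbove_W hw hCw x) v) a)
  have h2 : (⨅ v, G.W u x v) - a ≤ ⨅ v, G.W w x v :=
    le_ciInf fun v => by linarith [h v, ciInf_le (G.bddBelow_W hu hCu x) v]
  unfold mid
  linarith

lemma mid_const [Nonempty (Moves n G.ε)] (c : ℝ) (x : E n) : G.mid (fun _ => c) x = c := by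
  simp [mid, G.W_const]

/-! ### The geometry of the thickened domain -/

lemma subset_thickened : G.Ω ⊆ G.thickened := Set.subset_union_left

lemma mem_strip_of_mem_thickened {x : E n} (hx : x ∈ G.thickened) (hΩ : x ∉ G.Ω) :
    x ∈ G.strip := by
  rcases hx with h | h
  · exact absurd h hΩ
  · exact h.2

/-- If `x + z` is outside `Ω`, the segment back to `x` must cross the frontier, at distance at most
`‖z‖` from `x + z`. Hence averages taken at points of `Ω` only see `Ω_ε`. -/
lemma add_mem_thickened {x z : E n} (hx : x ∈ G.Ω) (hz : ‖z‖ ≤ G.ε) : x + z ∈ G.thickened := by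
  by_cases h : x + z ∈ G.Ω
  · exact Or.inl h
  · refine Or.inr ⟨h, ?_⟩
    have hconn : IsPreconnected (segment ℝ (x + z) x) := (convex_segment _ _).isPreconnected
    obtain ⟨y, hy, hyf⟩ : ∃ y ∈ segment ℝ (x + z) x, y ∈ frontier G.Ω := by
      by_contra! hno
      have hcl : ∀ y ∈ segment ℝ (x + z) x, y ∉ G.Ω → y ∈ (closure G.Ω)ᶜ := fun y hy hyΩ hyc =>
        hno y hy (by rw [G.isOpen.frontier_eq]; exact ⟨hyc, hyΩ⟩)
      obtain ⟨y, -, hy1, hy2⟩ := hconn G.Ω (closure G.Ω)ᶜ G.isOpen isClosed_closure.isOpen_compl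
        (fun y hy => or_iff_not_imp_left.mpr (hcl y hy)) ⟨x, right_mem_segment _ _ _, hx⟩
        ⟨x + z, left_mem_segment _ _ _, hcl _ (left_mem_segment _ _ _) h⟩
      exact hy2 (subset_closure hy1)
    refine (Metric.infDist_le_dist_of_mem hyf).trans ?_
    have h1 := dist_add_dist_of_mem_segment hy
    have h2 : dist (x + z) x = ‖z‖ := by simp [dist_eq_norm]
    linarith [dist_nonneg (x := y) (y := x)]

/-- Rules out the default value `0` of the distance to an empty set, which would make the strip the
whole space. -/
lemma frontier_nonempty (hn : 2 ≤ n) : (frontier G.Ω).Nonempty := by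
  have : Nontrivial (E n) :=
    Module.nontrivial_of_finrank_pos (R := ℝ) (by rw [finrank_euclideanSpace_fin]; omega)
  rw [Set.nonempty_iff_ne_empty, Ne, frontier_eq_empty_iff, not_or]
  refine ⟨G.isConnected.nonempty.ne_empty, fun h => ?_⟩
  have hb := G.isBounded
  rw [h] at hb
  exact NormedSpace.unbounded_univ ℝ (E n) hb

lemma isBounded_strip (hn : 2 ≤ n) : Bornology.IsBounded G.strip := by
  have hb : Bornology.IsBounded (frontier G.Ω) := G.isBounded.closure.subset frontier_subset_closure
  refine (hb.thickening (δ := G.ε + 1)).subset fun x hx => ?_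
  rw [Metric.mem_thickening_iff]
  refine (Metric.infDist_lt_iff (G.frontier_nonempty hn)).mp ?_
  exact lt_of_le_of_lt hx (lt_add_one _)

lemma isBounded_thickened (hn : 2 ≤ n) : Bornology.IsBounded G.thickened :=
  G.isBounded.union ((G.isBounded_strip hn).subset fun _ hx => hx.2)

lemma strip_nonempty (hn : 2 ≤ n) : G.strip.Nonempty := by
  obtain ⟨y, hy⟩ := G.frontier_nonempty hn
  refine ⟨y, ?_⟩
  simp only [strip, Set.mem_ofPred_eq, Metric.infDist_zero_of_mem hy, G.ε_pos.le]

lemma measurableSet_strip : MeasurableSet G.strip :=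
  measurableSet_le (Metric.continuous_infDist_pt _).measurable measurable_const

lemma δ_of_notMem {x : E n} (hx : x ∉ G.Ω) : G.δ x = 1 := if_neg hx

lemma δ_eq_zero {x : E n} (hx : x ∈ G.thickened) (hs : x ∉ G.strip) : G.δ x = 0 := by
  have hΩ : x ∈ G.Ω := by
    by_contra h
    exact hs (G.mem_strip_of_mem_thickened hx h)
  unfold δ
  exact (if_pos hΩ).trans (if_neg hs)

-- On `Ω` the two cases merge into `max 0 (1 - ε⁻¹ dist)`, which equals `1` on the frontier and so
-- matches the outer value.
open Classical in
lemma continuous_δ : Continuous G.δ := by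
  have h : G.δ = fun x => if x ∈ G.Ω then max 0 (1 - G.ε⁻¹ * Metric.infDist x (frontier G.Ω))
      else 1 := by
    funext x
    have hinv : 0 < G.ε⁻¹ := inv_pos.mpr G.ε_pos
    have hε : G.ε⁻¹ * G.ε = 1 := inv_mul_cancel₀ G.ε_pos.ne'
    unfold δ
    split_ifs with h1 h2
    · rw [max_eq_right]
      nlinarith
    · rw [max_eq_left]
      nlinarith
    · rfl
  rw [h]
  refine Continuous.if (fun x hx => ?_) ?_ continuous_const
  · have hx' : x ∈ frontier G.Ω := hx
    rw [Metric.infDist_zero_of_mem hx']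
    simp
  · exact continuous_const.max
      (continuous_const.sub (continuous_const.mul (Metric.continuous_infDist_pt _)))

/-- The boundary data extend to a bounded continuous function with the same infimum. -/
lemma exists_extension (hn : 2 ≤ n) : ∃ (f : E n → ℝ) (M : ℝ), Continuous f ∧
    Set.EqOn G.F f G.strip ∧ ∀ x, sInf (G.F '' G.strip) ≤ f x ∧ f x ≤ M := by
  obtain ⟨L, hL⟩ := G.lipschitz
  obtain ⟨g, hg, hgF⟩ := hL.extend_real
  have hb : Bornology.IsBounded (G.F '' G.strip) := by
    have h : G.F '' G.strip = g '' G.strip := Set.image_congr hgF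
    rw [h]
    exact hg.isBounded_image (G.isBounded_strip hn)
  obtain ⟨⟨a, ha⟩, ⟨b, hb⟩⟩ := isBounded_iff_bddBelow_bddAbove.mp hb
  set m := sInf (G.F '' G.strip) with hm
  have hmle : ∀ x ∈ G.strip, m ≤ G.F x := fun x hx => csInf_le ⟨a, ha⟩ ⟨x, hx, rfl⟩
  have hleb : ∀ x ∈ G.strip, G.F x ≤ b := fun x hx => hb ⟨x, hx, rfl⟩
  have hmb : m ≤ b := by
    obtain ⟨y, hy⟩ := G.strip_nonempty hn
    exact (hmle y hy).trans (hleb y hy)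
  -- Clamping a Lipschitz extension to `[m, b]` leaves its values on the strip unchanged. The lower
  -- clamp keeps the starting constant `m` below the boundary data, which makes the iterates
  -- increase.
  refine ⟨fun x => max m (min b (g x)), b, ?_, fun x hx => ?_, fun x => ⟨le_max_left _ _, ?_⟩⟩
  · exact continuous_const.max (continuous_const.min hg.continuous)
  · change G.F x = max m (min b (g x))
    rw [← hgF hx, min_eq_right (hleb x hx), max_eq_right (hmle x hx)]
  · exact max_le hmb (min_le_left _ _)

/-! ### A Lyapunov function -/

/-- Expanding `‖x + z‖ ^ 2` and using `1 + t ≤ exp t`, the disk average is at least `exp (l * ‖x‖ ^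
2) * (1 + l * c)`, with `c` the second moment: the linear term integrates to zero. The `α` part is
nonnegative and is dropped. -/
lemma two_mul_exp_le_W (hn : 2 ≤ n) : ∃ l : ℝ, 0 < l ∧ ∀ (x : E n) (v : Moves n G.ε),
    2 * Real.exp (l * ‖x‖ ^ 2) ≤ G.W (fun y => Real.exp (l * ‖y‖ ^ 2)) x v := by
  obtain ⟨e⟩ := G.nonempty_moves hn
  set c := ∫ z, ‖z‖ ^ 2 ∂(diskMeasure G.ε (e : E n))
  have hc : 0 < c := integral_norm_sq_diskMeasure_pos hn G.ε_pos _
  -- Chosen so that `β * l * c = 2`; `c` is the same for all directions by rotation invariance.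
  refine ⟨2 / (G.β * c), div_pos two_pos (mul_pos G.β_pos hc), fun x v => ?_⟩
  set l := 2 / (G.β * c) with hl
  have hlc : G.β * (l * c) = 2 := by
    rw [hl]
    field_simp [G.β_pos.ne']
  have := isProbabilityMeasure_diskMeasure G.ε_pos (v : E n)
  have hcv : ∫ z, ‖z‖ ^ 2 ∂(diskMeasure G.ε (v : E n)) = c :=
    integral_norm_sq_diskMeasure_eq (by rw [G.norm_move, G.norm_move])
  set φ := Real.exp (l * ‖x‖ ^ 2)
  have hφ : 0 < φ := Real.exp_pos _
  have i1 : Integrable (fun z : E n => l * ‖z‖ ^ 2) (diskMeasure G.ε (v : E n)) :=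
    integrable_diskMeasure G.ε_pos _ (by fun_prop)
  have i2 : Integrable (fun z : E n => 2 * l * inner ℝ x z) (diskMeasure G.ε (v : E n)) :=
    integrable_diskMeasure G.ε_pos _ (by fun_prop)
  have i12 : Integrable (fun z : E n => l * ‖z‖ ^ 2 + 2 * l * inner ℝ x z)
    (diskMeasure G.ε (v : E n)) := i1.add i2
  have h1 : ∫ z, φ * (l * ‖z‖ ^ 2 + 2 * l * inner ℝ x z + 1) ∂(diskMeasure G.ε (v : E n))
      = φ * (l * c + 1) := by
    rw [integral_const_mul, integral_add i12 (integrable_const _), integral_add i1 i2,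
      integral_const_mul, integral_const_mul, integral_inner_diskMeasure, hcv]
    simp
  have h2 : φ * (l * c + 1) ≤ ∫ z, Real.exp (l * ‖x + z‖ ^ 2) ∂(diskMeasure G.ε (v : E n)) := by
    rw [← h1]
    refine integral_mono (integrable_diskMeasure G.ε_pos _ (by fun_prop))
      (integrable_diskMeasure G.ε_pos _ (by fun_prop)) fun z => ?_
    have h3 : l * ‖x + z‖ ^ 2 = l * ‖x‖ ^ 2 + (l * ‖z‖ ^ 2 + 2 * l * inner ℝ x z) := by
      rw [norm_add_sq_real]
      ring
    simp only [h3, Real.exp_add (l * ‖x‖ ^ 2)]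
    exact mul_le_mul_of_nonneg_left (Real.add_one_le_exp _) hφ.le
  have h4 : 0 ≤ G.α * Real.exp (l * ‖x + v‖ ^ 2) := mul_nonneg G.α_nonneg (Real.exp_pos _).le
  have h5 := mul_le_mul_of_nonneg_left h2 G.β_pos.le
  have h6 : G.β * (φ * (l * c + 1)) = 2 * φ + G.β * φ := by linear_combination φ * hlc
  have h7 := mul_pos G.β_pos hφ
  unfold W
  linarith

/-- A bounded function which decreases by at least `1` on average in every turn of the game. -/
structure Lyapunov (ψ : E n → ℝ) (K : ℝ) : Prop where
  continuous : Continuous ψ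
  nonneg : ∀ x, 0 ≤ ψ x
  le : ∀ x, ψ x ≤ K
  one_le : ∀ x ∈ G.thickened, 1 ≤ ψ x
  W_le : ∀ x ∈ G.Ω, ∀ v, G.W ψ x v ≤ ψ x - 1

/-- Doubling of the exponential means that `K - exp (l * ‖x‖ ^ 2)` drops by at least the exponential
itself, which is at least `1`. With `R` bounding `Ω_ε`, the choice of `K` makes this function at
least `1` there, so the truncation at `0`, needed for global bounds, is invisible from `Ω`. -/
lemma exists_lyapunov (hn : 2 ≤ n) : ∃ ψ K, G.Lyapunov ψ K := by
  obtain ⟨l, hl, hW⟩ := G.two_mul_exp_le_W hn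
  obtain ⟨R, hR⟩ := (G.isBounded_thickened hn).exists_norm_le
  set K := 1 + Real.exp (l * R ^ 2)
  have hthick : ∀ x ∈ G.thickened, 1 ≤ K - Real.exp (l * ‖x‖ ^ 2) := fun x hx => by
    have : Real.exp (l * ‖x‖ ^ 2) ≤ Real.exp (l * R ^ 2) :=
      Real.exp_le_exp.mpr (mul_le_mul_of_nonneg_left
        (pow_le_pow_left₀ (norm_nonneg x) (hR x hx) 2) hl.le)
    linarith
  refine ⟨fun x => max (K - Real.exp (l * ‖x‖ ^ 2)) 0, K, by fun_prop, fun x => le_max_right _ _,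
    fun x => max_le ?_ ?_, fun x hx => (hthick x hx).trans (le_max_left _ _), fun x hx v => ?_⟩
  · linarith [Real.exp_pos (l * ‖x‖ ^ 2)]
  · positivity
  · have h1 : ∀ y ∈ G.thickened, max (K - Real.exp (l * ‖y‖ ^ 2)) 0
        = K + -1 * Real.exp (l * ‖y‖ ^ 2) + 0 := fun y hy => by
      rw [max_eq_left (zero_le_one.trans (hthick y hy))]
      ring
    rw [G.W_congr (w := fun y => K + -1 * Real.exp (l * ‖y‖ ^ 2) + 0)
      fun z hz => h1 _ (G.add_mem_thickened hx hz), h1 x (G.subset_thickened hx),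
      G.W_add_mul continuous_const (by fun_prop), G.W_const]
    have h2 : 1 ≤ Real.exp (l * ‖x‖ ^ 2) := Real.one_le_exp (by positivity)
    linarith [hW x v]

variable {G} in
lemma Lyapunov.one_le_bound {ψ : E n → ℝ} {K : ℝ} (h : G.Lyapunov ψ K) : 1 ≤ K := by
  obtain ⟨x, hx⟩ := G.isConnected.nonempty
  exact (h.one_le x (G.subset_thickened hx)).trans (h.le x)

-- Since `ψ ≤ K`, losing `1` is losing at least the fraction `K⁻¹`: additive drift becomes geometric
-- decay.
variable {G} in
lemma Lyapunov.sub_one_le {ψ : E n → ℝ} {K : ℝ} (h : G.Lyapunov ψ K) (x : E n) :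
    ψ x - 1 ≤ (1 - K⁻¹) * ψ x := by
  have hK : 0 < K := zero_lt_one.trans_le h.one_le_bound
  have : K⁻¹ * ψ x ≤ 1 := by
    rw [← inv_mul_cancel₀ hK.ne']
    exact mul_le_mul_of_nonneg_left (h.le x) (inv_nonneg.mpr hK.le)
  linarith

variable {G} in
lemma Lyapunov.rate_nonneg {ψ : E n → ℝ} {K : ℝ} (h : G.Lyapunov ψ K) : 0 ≤ 1 - K⁻¹ :=
  sub_nonneg.mpr (inv_le_one_of_one_le₀ h.one_le_bound)

variable {G} in
lemma Lyapunov.tendsto_rate_pow {ψ : E n → ℝ} {K : ℝ} (h : G.Lyapunov ψ K) :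
    Tendsto (fun k => (1 - K⁻¹) ^ k) atTop (𝓝 0) :=
  tendsto_pow_atTop_nhds_zero_of_lt_one h.rate_nonneg
    (sub_lt_self _ (inv_pos.mpr (zero_lt_one.trans_le h.one_le_bound)))

/-! ### The dynamic programming operator with extended boundary data -/

/-- The operator `I` with boundary data `f` given on the whole space. -/
def dpp (f u : E n → ℝ) (x : E n) : ℝ := (1 - G.δ x) * G.mid u x + G.δ x * f x

/-- Inside `Ω_ε`, the weight `δ` vanishes off the strip, and `1 - δ` vanishes off `Ω`. So the
original operator may be replaced by one preserving continuity on the whole space. -/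
lemma op_eq_dpp {f u w : E n → ℝ} (hf : Set.EqOn G.F f G.strip)
    (huw : Set.EqOn u w G.thickened) : Set.EqOn (G.op u) (G.dpp f w) G.thickened := by
  intro x hx
  have h1 : G.δ x * G.F x = G.δ x * f x := by
    by_cases hs : x ∈ G.strip
    · rw [hf hs]
    · rw [G.δ_eq_zero hx hs, zero_mul, zero_mul]
  have h2 : (1 - G.δ x) * G.mid u x = (1 - G.δ x) * G.mid w x := by
    by_cases hΩ : x ∈ G.Ω
    · unfold mid
      simp only [G.W_congr fun z hz => huw (G.add_mem_thickened hΩ hz)]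
    · rw [G.δ_of_notMem hΩ, sub_self, zero_mul, zero_mul]
  unfold op dpp
  rw [h1, ← h2]
  unfold mid
  ring

lemma iter_eq_dpp_iterate {f : E n → ℝ} (hf : Set.EqOn G.F f G.strip) (k : ℕ) :
    Set.EqOn (G.iter k) ((G.dpp f)^[k] fun _ => sInf (G.F '' G.strip)) G.thickened := by
  induction k with
  | zero => exact fun x _ => rfl
  | succ k ih =>
    unfold iter at ih ⊢
    rw [Function.iterate_succ_apply', Function.iterate_succ_apply']
    exact G.op_eq_dpp hf ih

lemma continuous_dpp {f u : E n → ℝ} (hf : Continuous f) (hu : Continuous u) {C : ℝ}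
    (hC : ∀ x, |u x| ≤ C) : Continuous (G.dpp f u) :=
  ((continuous_const.sub G.continuous_δ).mul (G.continuous_mid hu hC)).add (G.continuous_δ.mul hf)

lemma dpp_mono [Nonempty (Moves n G.ε)] {f u w : E n → ℝ} (hu : Continuous u)
    (hw : Continuous w) {C : ℝ} (hCu : ∀ x, |u x| ≤ C) (hCw : ∀ x, |w x| ≤ C)
    (h : ∀ x, u x ≤ w x) (x : E n) : G.dpp f u x ≤ G.dpp f w x := by
  have h1 := G.mid_le_mid_add hu hw hCu hCw (x := x) (a := 0)
    fun v => by rw [add_zero]; exact G.W_mono hu hw (fun z _ => h _) v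
  rw [add_zero] at h1
  exact add_le_add_left (mul_le_mul_of_nonneg_left h1 (sub_nonneg.mpr (G.δ_le_one x))) _

lemma dpp_mem_Icc [Nonempty (Moves n G.ε)] {f u : E n → ℝ} {m M : ℝ} (hu : Continuous u)
    (hfm : ∀ x, m ≤ f x ∧ f x ≤ M) (hum : ∀ x, m ≤ u x ∧ u x ≤ M) (x : E n) :
    m ≤ G.dpp f u x ∧ G.dpp f u x ≤ M := by
  have hC : ∀ y, |u y| ≤ max |m| |M| := fun y => abs_le_max_abs_abs (hum y).1 (hum y).2
  have hmM : m ≤ M := (hfm 0).1.trans (hfm 0).2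
  have hCm : ∀ y : E n, |(fun _ => m) y| ≤ max |m| |M| := fun y => le_max_left _ _
  have hCM : ∀ y : E n, |(fun _ => M) y| ≤ max |m| |M| := fun y => le_max_right _ _
  have h1 := G.mid_le_mid_add continuous_const hu hCm hC (x := x) (a := 0)
    fun v => by rw [add_zero]; exact G.W_mono continuous_const hu (fun z _ => (hum _).1) v
  have h2 := G.mid_le_mid_add hu continuous_const hC hCM (x := x) (a := 0)
    fun v => by rw [add_zero]; exact G.W_mono hu continuous_const (fun z _ => (hum _).2) v
  rw [mid_const, add_zero] at h1 h2
  have h3 := G.δ_nonneg x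
  have h4 := sub_nonneg.mpr (G.δ_le_one x)
  unfold dpp
  constructor
  · linarith [mul_le_mul_of_nonneg_left h1 h4, mul_le_mul_of_nonneg_left (hfm x).1 h3]
  · linarith [mul_le_mul_of_nonneg_left h2 h4, mul_le_mul_of_nonneg_left (hfm x).2 h3]

lemma dpp_iterate_regular [Nonempty (Moves n G.ε)] {f : E n → ℝ} {m M : ℝ} (hf : Continuous f)
    (hfm : ∀ x, m ≤ f x ∧ f x ≤ M) (k : ℕ) :
    Continuous ((G.dpp f)^[k] fun _ => m) ∧
      ∀ x, m ≤ ((G.dpp f)^[k] fun _ => m) x ∧ ((G.dpp f)^[k] fun _ => m) x ≤ M := by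
  induction k with
  | zero => exact ⟨continuous_const, fun x => ⟨le_rfl, (hfm x).1.trans (hfm x).2⟩⟩
  | succ k ih =>
    rw [Function.iterate_succ_apply']
    exact ⟨G.continuous_dpp hf ih.1 (C := max |m| |M|)
      fun y => abs_le_max_abs_abs (ih.2 y).1 (ih.2 y).2, G.dpp_mem_Icc ih.1 hfm ih.2⟩

/-- The first step cannot go below the lower bound `m`, and monotonicity of the operator propagates
this. -/
lemma dpp_iterate_le_succ [Nonempty (Moves n G.ε)] {f : E n → ℝ} {m M : ℝ} (hf : Continuous f)
    (hfm : ∀ x, m ≤ f x ∧ f x ≤ M) (k : ℕ) (x : E n) :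
    ((G.dpp f)^[k] fun _ => m) x ≤ ((G.dpp f)^[k + 1] fun _ => m) x := by
  induction k generalizing x with
  | zero => exact ((G.dpp_iterate_regular hf hfm 1).2 x).1
  | succ k ih =>
    have h1 := G.dpp_iterate_regular hf hfm k
    have h2 := G.dpp_iterate_regular hf hfm (k + 1)
    rw [Function.iterate_succ_apply', Function.iterate_succ_apply' _ (k + 1)]
    exact G.dpp_mono h1.1 h2.1 (C := max |m| |M|)
      (fun y => abs_le_max_abs_abs (h1.2 y).1 (h1.2 y).2)
      (fun y => abs_le_max_abs_abs (h2.2 y).1 (h2.2 y).2) ih x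

/-- A one-sided contraction with weight `ψ`: in `Ω` the average of `ψ` gains the factor `1 - K⁻¹`,
while off `Ω` both sides reduce to the boundary data. -/
lemma dpp_sub_le [Nonempty (Moves n G.ε)] {f u w ψ : E n → ℝ} {K : ℝ} (hψ : G.Lyapunov ψ K)
    (hu : Continuous u) (hw : Continuous w) {C : ℝ} (hCu : ∀ x, |u x| ≤ C) (hCw : ∀ x, |w x| ≤ C)
    {a : ℝ} (ha : 0 ≤ a) (h : ∀ x ∈ G.thickened, w x ≤ u x + a * ψ x) (x : E n) :
    G.dpp f w x ≤ G.dpp f u x + a * (1 - K⁻¹) * ψ x := by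
  have h0 : 0 ≤ a * (1 - K⁻¹) * ψ x := mul_nonneg (mul_nonneg ha hψ.rate_nonneg) (hψ.nonneg x)
  unfold dpp
  by_cases hΩ : x ∈ G.Ω
  · have h1 : G.mid w x ≤ G.mid u x + a * (1 - K⁻¹) * ψ x := by
      refine G.mid_le_mid_add hw hu hCw hCu fun v => ?_
      have h2 : G.W w x v ≤ G.W (fun y => u y + a * ψ y + 0) x v :=
        G.W_mono hw (by have := hψ.continuous; fun_prop)
          (fun z hz => by rw [add_zero]; exact h _ (G.add_mem_thickened hΩ hz)) v
      rw [G.W_add_mul hu hψ.continuous] at h2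
      have h3 := mul_le_mul_of_nonneg_left ((hψ.W_le x hΩ v).trans (hψ.sub_one_le x)) ha
      linarith
    have h4 := mul_le_mul_of_nonneg_left h1 (sub_nonneg.mpr (G.δ_le_one x))
    have h5 := mul_nonneg (G.δ_nonneg x) h0
    linarith
  · rw [G.δ_of_notMem hΩ]
    linarith

lemma dpp_iterate_succ_le [Nonempty (Moves n G.ε)] {f ψ : E n → ℝ} {m M K : ℝ}
    (hf : Continuous f) (hfm : ∀ x, m ≤ f x ∧ f x ≤ M) (hψ : G.Lyapunov ψ K) (k : ℕ) {x : E n}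
    (hx : x ∈ G.thickened) :
    ((G.dpp f)^[k + 1] fun _ => m) x
      ≤ ((G.dpp f)^[k] fun _ => m) x + (M - m) * (1 - K⁻¹) ^ k * ψ x := by
  have hmM : 0 ≤ M - m := sub_nonneg.mpr ((hfm 0).1.trans (hfm 0).2)
  induction k generalizing x with
  | zero =>
    have h1 := ((G.dpp_iterate_regular hf hfm 1).2 x).2
    -- The first increment is at most `M - m`, hence at most `(M - m) * ψ x` because `ψ ≥ 1` on
    -- `Ω_ε`.
    have h2 := mul_le_mul_of_nonneg_left (hψ.one_le x hx) hmM
    simp only [pow_zero, mul_one, Function.iterate_zero, id_eq]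
    linarith
  | succ k ih =>
    have h1 := G.dpp_iterate_regular hf hfm k
    have h2 := G.dpp_iterate_regular hf hfm (k + 1)
    rw [Function.iterate_succ_apply' _ (k + 1), Function.iterate_succ_apply' _ k]
    have ha : 0 ≤ (M - m) * (1 - K⁻¹) ^ k := mul_nonneg hmM (pow_nonneg hψ.rate_nonneg k)
    set a := (M - m) * (1 - K⁻¹) ^ k
    have h3 := G.dpp_sub_le hψ h1.1 h2.1 (C := max |m| |M|) (f := f)
      (fun y => abs_le_max_abs_abs (h1.2 y).1 (h1.2 y).2)
      (fun y => abs_le_max_abs_abs (h2.2 y).1 (h2.2 y).2) ha (fun y hy => ih hy) x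
    rwa [mul_assoc (M - m), ← pow_succ, Function.iterate_succ_apply' _ k] at h3

/-! ### One turn of the game -/

/-- The expectation of `f` after the end-of-game lottery at `y`. -/
def lottery (f : State n → ℝ) (y : E n) : ℝ := G.δ y * f (y, true) + (1 - G.δ y) * f (y, false)

lemma integral_endKernel (f : State n → ℝ) (y : E n) :
    ∫ s, f s ∂(G.endKernel y) = G.lottery f y := by
  change ∫ s, f s ∂(ENNReal.ofReal (G.δ y) • Measure.dirac (y, true) +
    ENNReal.ofReal (1 - G.δ y) • Measure.dirac (y, false)) = _
  have hi : ∀ b : Bool, Integrable f (Measure.dirac ((y, b) : State n)) := fun b =>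
    integrable_dirac enorm_lt_top
  rw [integral_add_measure ((hi true).smul_measure ENNReal.ofReal_ne_top)
    ((hi false).smul_measure ENNReal.ofReal_ne_top), integral_smul_measure, integral_smul_measure,
    integral_dirac, integral_dirac, ENNReal.toReal_ofReal (G.δ_nonneg y),
    ENNReal.toReal_ofReal (sub_nonneg.mpr (G.δ_le_one y))]
  rfl

lemma abs_lottery_le {f : State n → ℝ} {C : ℝ} (hC : ∀ s, |f s| ≤ C) (y : E n) :
    |G.lottery f y| ≤ C := by
  rw [← G.integral_endKernel]
  have h := norm_integral_le_of_norm_le_const (μ := G.endKernel y) (f := f) (C := C)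
    (ae_of_all _ fun s => hC s)
  simpa using h

lemma measurable_lottery {f : State n → ℝ} (hf : Measurable f) : Measurable (G.lottery f) := by
  have := G.measurable_δ
  unfold lottery
  fun_prop

lemma integral_moveKernel {f : E n → ℝ} (hf : Measurable f) {C : ℝ} (hC : ∀ y, |f y| ≤ C)
    (x : E n) (v : Moves n G.ε) : ∫ y, f y ∂(G.moveKernel (x, v)) = G.W f x v := by
  change ∫ y, f y ∂(ENNReal.ofReal G.α • Measure.dirac (x + (v : E n)) +
    ENNReal.ofReal G.β • Measure.map (fun z => x + z) (diskMeasure G.ε (v : E n))) = _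
  have := isProbabilityMeasure_diskMeasure G.ε_pos (v : E n)
  have : IsProbabilityMeasure (Measure.map (fun z => x + z) (diskMeasure G.ε (v : E n))) :=
    Measure.isProbabilityMeasure_map (by fun_prop)
  rw [integral_add_measure, integral_smul_measure, integral_smul_measure, integral_dirac,
    integral_map (by fun_prop) hf.aestronglyMeasurable, ENNReal.toReal_ofReal G.α_nonneg,
    ENNReal.toReal_ofReal G.β_pos.le]
  · rfl
  · exact (integrable_dirac enorm_lt_top).smul_measure ENNReal.ofReal_ne_top
  · exact (Integrable.of_bound hf.aestronglyMeasurable C (ae_of_all _ hC)).smul_measure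
      ENNReal.ofReal_ne_top

lemma integral_coinKernel (SI SII : G.Strategy) {k : ℕ} {f : E n → ℝ} (hf : Measurable f) {C : ℝ}
    (hC : ∀ y, |f y| ≤ C) (h : Finset.Iic k → State n) :
    ∫ y, f y ∂(G.coinKernel SI SII k h) =
      (G.W f (last k h).1 (SI.1 k (positions k h)) +
        G.W f (last k h).1 (SII.1 k (positions k h))) / 2 := by
  change ∫ y, f y ∂((2⁻¹ : ℝ≥0∞) • G.playerKernel SI k h +
    (2⁻¹ : ℝ≥0∞) • G.playerKernel SII k h) = _
  have hp : ∀ S : G.Strategy, ∫ y, f y ∂(G.playerKernel S k h)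
      = G.W f (last k h).1 (S.1 k (positions k h)) := fun S => by
    rw [playerKernel, Kernel.comap_apply, G.integral_moveKernel hf hC]
  have hi : ∀ S : G.Strategy, Integrable f ((2⁻¹ : ℝ≥0∞) • G.playerKernel S k h) := fun S =>
    (Integrable.of_bound hf.aestronglyMeasurable C (ae_of_all _ hC)).smul_measure (by simp)
  rw [integral_add_measure (hi SI) (hi SII), integral_smul_measure, integral_smul_measure, hp, hp]
  simp only [ENNReal.toReal_inv, ENNReal.toReal_ofNat, smul_eq_mul]
  ring

lemma turnKernel_of_ended (SI SII : G.Strategy) {k : ℕ} {h : Finset.Iic k → State n}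
    (hh : (last k h).2 = true) : G.turnKernel SI SII k h = Measure.dirac (last k h) := by
  classical
  rw [turnKernel, Kernel.piecewise_apply, if_pos (by exact hh), Kernel.deterministic_apply]

lemma integral_turnKernel_of_not_ended (SI SII : G.Strategy) {k : ℕ}
    {h : Finset.Iic k → State n} (hh : (last k h).2 = false) {f : State n → ℝ}
    (hf : Measurable f) {C : ℝ} (hC : ∀ s, |f s| ≤ C) :
    ∫ s, f s ∂(G.turnKernel SI SII k h) =
      (G.W (G.lottery f) (last k h).1 (SI.1 k (positions k h)) +
        G.W (G.lottery f) (last k h).1 (SII.1 k (positions k h))) / 2 := by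
  classical
  rw [turnKernel, Kernel.piecewise_apply, if_neg (by simp [hh]), Kernel.integral_comp]
  · simp only [G.integral_endKernel]
    exact G.integral_coinKernel SI SII (G.measurable_lottery hf) (G.abs_lottery_le hC) h
  · exact Integrable.of_bound hf.aestronglyMeasurable C (ae_of_all _ hC)

/-- The states which can be reached in the game. -/
def reachable : Set (State n) :=
  {s | (s.2 = true → s.1 ∈ G.strip) ∧ (s.2 = false → s.1 ∈ G.Ω)}

lemma measurableSet_reachable : MeasurableSet G.reachable := by
  have h : ∀ b : Bool, MeasurableSet {s : State n | s.2 = b} := fun b =>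
    measurable_snd (measurableSet_singleton b)
  have h1 : MeasurableSet {s : State n | s.1 ∈ G.strip} := measurable_fst G.measurableSet_strip
  have h2 : MeasurableSet {s : State n | s.1 ∈ G.Ω} := measurable_fst G.isOpen.measurableSet
  exact ((h true).imp h1).inter ((h false).imp h2)

/-- Each unreachable outcome has weight zero: ending off the strip since `δ = 0` there, continuing
off `Ω` since `δ = 1` there. -/
lemma lottery_indicator_reachable_compl {y : E n} (hy : y ∈ G.thickened) :
    G.lottery (G.reachableᶜ.indicator 1) y = 0 := by
  have h1 : G.δ y * G.reachableᶜ.indicator (1 : State n → ℝ) (y, true) = 0 := by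
    by_cases hs : y ∈ G.strip
    · simp [reachable, hs]
    · simp [G.δ_eq_zero hy hs]
  have h2 : (1 - G.δ y) * G.reachableᶜ.indicator (1 : State n → ℝ) (y, false) = 0 := by
    by_cases hΩ : y ∈ G.Ω
    · simp [reachable, hΩ]
    · simp [G.δ_of_notMem hΩ]
  rw [lottery, h1, h2, add_zero]

lemma abs_indicator_one_le {α : Type*} (s : Set α) (a : α) : |s.indicator (1 : α → ℝ) a| ≤ 1 := by
  by_cases h : a ∈ s <;> simp [h]

lemma ae_endKernel_mem_reachable {x : E n} (hx : x ∈ G.thickened) :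
    ∀ᵐ s ∂(G.endKernel x), s ∈ G.reachable := by
  have h := G.integral_endKernel (G.reachableᶜ.indicator 1) x
  rw [G.lottery_indicator_reachable_compl hx,
    integral_indicator_one G.measurableSet_reachable.compl, measureReal_eq_zero_iff] at h
  exact h

lemma ae_turnKernel_mem_reachable (SI SII : G.Strategy) {k : ℕ} {h : Finset.Iic k → State n}
    (hh : last k h ∈ G.reachable) : ∀ᵐ s ∂(G.turnKernel SI SII k h), s ∈ G.reachable := by
  cases hb : (last k h).2 with
  | true =>
    rw [G.turnKernel_of_ended SI SII hb, ae_dirac_iff (p := fun s => s ∈ G.reachable) G.measurableSet_reachable]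
    exact hh
  | false =>
    have h0 := G.integral_turnKernel_of_not_ended SI SII hb
      (f := G.reachableᶜ.indicator 1)
      (measurable_one.indicator G.measurableSet_reachable.compl) (abs_indicator_one_le _)
    have hW : ∀ v, G.W (G.lottery (G.reachableᶜ.indicator 1)) (last k h).1 v = 0 := fun v => by
      rw [G.W_congr (w := fun _ => 0) fun z hz => G.lottery_indicator_reachable_compl
        (G.add_mem_thickened (hh.2 hb) hz), G.W_const]
    rw [hW, hW, integral_indicator_one G.measurableSet_reachable.compl, add_zero, zero_div,
      measureReal_eq_zero_iff] at h0
    exact h0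

/-! ### The law of the game -/

instance (SI SII : G.Strategy) (x : E n) : IsProbabilityMeasure (G.law SI SII x) := by
  unfold law
  infer_instance

lemma measurable_state (k : ℕ) : Measurable fun ω : ℕ → State n => ω k := measurable_pi_apply k

lemma map_law_zero (SI SII : G.Strategy) (x : E n) :
    (G.law SI SII x).map (fun ω => ω 0) = G.endKernel x := by
  have h1 : (fun ω : ℕ → State n => ω 0) =
      (fun h : Finset.Iic 0 → State n => h ⟨0, by simp⟩) ∘ Preorder.frestrictLe 0 := rfl
  rw [h1, ← Measure.map_map (by fun_prop) (by fun_prop), law, Kernel.trajMeasure,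
    Measure.map_comp _ _ (by fun_prop), Kernel.traj_map_frestrictLe, Kernel.partialTraj_self,
    Measure.id_comp, Measure.map_map (by fun_prop) (by fun_prop)]
  exact Measure.map_id

lemma map_law_succ (SI SII : G.Strategy) (x : E n) (k : ℕ) :
    (G.law SI SII x).map (Preorder.frestrictLe k) ⊗ₘ G.turnKernel SI SII k =
      (G.law SI SII x).map fun ω => (Preorder.frestrictLe k ω, ω (k + 1)) :=
  Kernel.map_frestrictLe_trajMeasure_compProd_eq_map_trajMeasure

lemma measurable_prefix_next (k : ℕ) : Measurable fun ω : ℕ → State n =>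
    ((Preorder.frestrictLe k ω : Finset.Iic k → State n), ω (k + 1)) := by
  fun_prop

lemma integral_law_zero (SI SII : G.Strategy) (x : E n) {f : State n → ℝ} (hf : Measurable f) :
    ∫ ω, f (ω 0) ∂(G.law SI SII x) = G.lottery f x := by
  rw [← G.integral_endKernel, ← G.map_law_zero SI SII x,
    integral_map (measurable_state 0).aemeasurable hf.aestronglyMeasurable]

lemma integral_law_succ (SI SII : G.Strategy) (x : E n) (k : ℕ) {f : State n → ℝ}
    (hf : Measurable f) {C : ℝ} (hC : ∀ s, |f s| ≤ C) :
    ∫ ω, f (ω (k + 1)) ∂(G.law SI SII x) =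
      ∫ ω, ∫ s, f s ∂(G.turnKernel SI SII k (Preorder.frestrictLe k ω)) ∂(G.law SI SII x) := by
  have hprob : IsProbabilityMeasure ((G.law SI SII x).map
      (Preorder.frestrictLe k : (ℕ → State n) → (Finset.Iic k → State n))) :=
    Measure.isProbabilityMeasure_map (by fun_prop)
  have h1 : ∫ ω, f (ω (k + 1)) ∂(G.law SI SII x) = ∫ p, f p.2 ∂((G.law SI SII x).map
      fun ω => ((Preorder.frestrictLe k ω : Finset.Iic k → State n), ω (k + 1))) := by
    exact (integral_map (measurable_prefix_next k).aemeasurable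
      (f := fun p : (Finset.Iic k → State n) × State n => f p.2)
      (hf.comp measurable_snd).aestronglyMeasurable).symm
  rw [h1, ← G.map_law_succ, Measure.integral_compProd]
  · refine integral_map (by fun_prop) ?_
    exact (StronglyMeasurable.integral_kernel hf.stronglyMeasurable).aestronglyMeasurable
  · exact Integrable.of_bound (hf.comp measurable_snd).aestronglyMeasurable C
      (ae_of_all _ fun p => hC p.2)

lemma ae_law_succ (SI SII : G.Strategy) (x : E n) (k : ℕ)
    {p : (Finset.Iic k → State n) → State n → Prop} (hp : MeasurableSet {q : _ × _ | p q.1 q.2})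
    (h : ∀ᵐ ω ∂(G.law SI SII x), ∀ᵐ s ∂(G.turnKernel SI SII k (Preorder.frestrictLe k ω)),
      p (Preorder.frestrictLe k ω) s) :
    ∀ᵐ ω ∂(G.law SI SII x), p (Preorder.frestrictLe k ω) (ω (k + 1)) := by
  have hprob : IsProbabilityMeasure ((G.law SI SII x).map
      (Preorder.frestrictLe k : (ℕ → State n) → (Finset.Iic k → State n))) :=
    Measure.isProbabilityMeasure_map (by fun_prop)
  have h1 : ∀ᵐ q ∂((G.law SI SII x).map (Preorder.frestrictLe k) ⊗ₘ G.turnKernel SI SII k),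
      p q.1 q.2 := by
    rw [Measure.ae_compProd_iff hp, ae_map_iff (by fun_prop)]
    · exact h
    · have h2 := Kernel.measurable_kernel_prodMk_left (κ := G.turnKernel SI SII k) hp.compl
      exact h2 (measurableSet_singleton 0)
  rw [G.map_law_succ] at h1
  exact ae_of_ae_map (measurable_prefix_next k).aemeasurable h1

lemma ae_law_mem_reachable (SI SII : G.Strategy) {x : E n} (hx : x ∈ G.thickened) (k : ℕ) :
    ∀ᵐ ω ∂(G.law SI SII x), ω k ∈ G.reachable := by
  induction k with
  | zero =>
    have h := G.ae_endKernel_mem_reachable hx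
    rw [← G.map_law_zero SI SII x] at h
    exact ae_of_ae_map (measurable_state 0).aemeasurable h
  | succ k ih =>
    refine G.ae_law_succ SI SII x k (p := fun _ s => s ∈ G.reachable)
      (measurable_snd G.measurableSet_reachable) ?_
    filter_upwards [ih] with ω hω
    exact G.ae_turnKernel_mem_reachable SI SII hω

lemma ae_law_succ_eq (SI SII : G.Strategy) (x : E n) (k : ℕ) :
    ∀ᵐ ω ∂(G.law SI SII x), (ω k).2 = true → ω (k + 1) = ω k := by
  refine G.ae_law_succ SI SII x k (p := fun h s => (last k h).2 = true → s = last k h) ?_ ?_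
  · have h1 : MeasurableSet {q : (Finset.Iic k → State n) × State n | (last k q.1).2 = true} :=
      measurable_fst (measurableSet_ended k)
    exact h1.imp (measurableSet_eq_fun measurable_snd ((measurable_last k).comp measurable_fst))
  · refine ae_of_all _ fun ω => ?_
    cases hb : (last k (Preorder.frestrictLe k ω : Finset.Iic k → State n)).2 with
    | true =>
      rw [G.turnKernel_of_ended SI SII hb,
        ae_dirac_iff (p := fun s => true = true → s = last k _)
          (by simp)]
      exact fun _ => rfl
    | false => exact ae_of_all _ fun s hs => absurd hs (by simp)

/-- A bounded function of the state which decreases by the factor `c` on average in every turn. -/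
lemma integral_law_succ_le (SI SII : G.Strategy) {x : E n} (hx : x ∈ G.thickened) (k : ℕ)
    {f : State n → ℝ} (hf : Measurable f) {C : ℝ} (hC : ∀ s, |f s| ≤ C) {c : ℝ}
    (hended : ∀ y ∈ G.strip, f (y, true) ≤ c * f (y, true))
    (hturn : ∀ h : Finset.Iic k → State n, (last k h).1 ∈ G.Ω →
      G.W (G.lottery f) (last k h).1 (SI.1 k (positions k h)) +
        G.W (G.lottery f) (last k h).1 (SII.1 k (positions k h))
          ≤ 2 * (c * f ((last k h).1, false))) :
    ∫ ω, f (ω (k + 1)) ∂(G.law SI SII x) ≤ c * ∫ ω, f (ω k) ∂(G.law SI SII x) := by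
  rw [G.integral_law_succ SI SII x k hf hC, ← integral_const_mul]
  refine integral_mono_ae ?_ ?_ ?_
  · refine Integrable.of_bound (C := C) ?_ (ae_of_all _ fun ω => ?_)
    · have h1 : StronglyMeasurable fun h : Finset.Iic k → State n =>
          ∫ s, f s ∂(G.turnKernel SI SII k h) :=
        StronglyMeasurable.integral_kernel hf.stronglyMeasurable
      exact (h1.comp_measurable (by fun_prop)).aestronglyMeasurable
    · refine (norm_integral_le_of_norm_le_const (ae_of_all _ hC)).trans ?_
      simp
  · refine Integrable.const_mul ?_ c
    exact Integrable.of_bound (hf.comp (measurable_state k)).aestronglyMeasurable C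
      (ae_of_all _ fun ω => hC _)
  · filter_upwards [G.ae_law_mem_reachable SI SII hx k] with ω hω
    have hlast : last k (Preorder.frestrictLe k ω : Finset.Iic k → State n) = ω k := rfl
    cases hb : (ω k).2 with
    | true =>
      rw [G.turnKernel_of_ended SI SII (hlast ▸ hb), integral_dirac, hlast]
      have h1 := hended _ (hω.1 hb)
      rwa [← hb] at h1
    | false =>
      rw [G.integral_turnKernel_of_not_ended SI SII (hlast ▸ hb) hf hC]
      have h1 := hturn (Preorder.frestrictLe k ω) (hω.2 hb)
      rw [hlast] at h1 ⊢
      have h2 : ((ω k).1, false) = ω k := by rw [← hb]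
      rw [h2] at h1
      linarith

/-! ### The end of the game -/

/-- Markov's inequality for the function equal to `ψ` at running states and `0` at ended ones. It is
at least `1` while the game runs, and the lottery can only lower its mean. -/
lemma measureReal_not_ended_le (SI SII : G.Strategy) {x : E n} (hx : x ∈ G.thickened)
    {ψ : E n → ℝ} {K : ℝ} (hψ : G.Lyapunov ψ K) (k : ℕ) :
    (G.law SI SII x).real {ω | (ω k).2 = false} ≤ (1 - K⁻¹) ^ k * K := by
  set f : State n → ℝ := fun s => if s.2 = true then 0 else ψ s.1 with hf_def
  have hset : ∀ b : Bool, MeasurableSet {s : State n | s.2 = b} := fun b =>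
    measurable_snd (measurableSet_singleton b)
  have hf : Measurable f :=
    Measurable.ite (hset true) measurable_const (hψ.continuous.measurable.comp measurable_fst)
  have hK : 0 ≤ K := zero_le_one.trans hψ.one_le_bound
  have hf0 : ∀ s, 0 ≤ f s := fun s => by
    simp only [hf_def]
    split_ifs
    exacts [le_rfl, hψ.nonneg _]
  have hfK : ∀ s, f s ≤ K := fun s => by
    simp only [hf_def]
    split_ifs
    exacts [hK, hψ.le _]
  have hC : ∀ s, |f s| ≤ K := fun s => by rw [abs_of_nonneg (hf0 s)]; exact hfK s
  have hlot : G.lottery f = fun y => (1 - G.δ y) * ψ y := by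
    funext y
    simp [lottery, hf_def]
  have hdecay : ∀ j, ∫ ω, f (ω j) ∂(G.law SI SII x) ≤ (1 - K⁻¹) ^ j * K := by
    intro j
    induction j with
    | zero =>
      rw [G.integral_law_zero SI SII x hf, pow_zero, one_mul]
      exact (abs_le.mp (G.abs_lottery_le hC x)).2
    | succ j ih =>
      refine (G.integral_law_succ_le SI SII hx j hf hC (c := 1 - K⁻¹) ?_ ?_).trans ?_
      · intro y _
        simp [hf_def]
      · intro h hΩ
        have h1 : ∀ v, G.W (G.lottery f) (last j h).1 v ≤ (1 - K⁻¹) * ψ (last j h).1 := by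
          intro v
          refine (G.W_mono (w := ψ) ?_ hψ.continuous (fun z _ => ?_) v).trans
            ((hψ.W_le _ hΩ v).trans (hψ.sub_one_le _))
          · rw [hlot]
            exact (continuous_const.sub G.continuous_δ).mul hψ.continuous
          · rw [hlot]
            have := mul_nonneg (G.δ_nonneg ((last j h).1 + z)) (hψ.nonneg ((last j h).1 + z))
            simp only
            linarith
        have h2 : f ((last j h).1, false) = ψ (last j h).1 := by simp [hf_def]
        rw [h2]
        linarith [h1 (SI.1 j (positions j h)), h1 (SII.1 j (positions j h))]
      · rw [pow_succ']
        rw [mul_assoc]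
        exact mul_le_mul_of_nonneg_left ih hψ.rate_nonneg
  refine le_trans ?_ (hdecay k)
  have hmeas : MeasurableSet {ω : ℕ → State n | (ω k).2 = false} :=
    measurable_state k (hset false)
  rw [← integral_indicator_one hmeas]
  refine integral_mono_ae ((integrable_const (1 : ℝ)).indicator hmeas)
    (Integrable.of_bound (hf.comp (measurable_state k)).aestronglyMeasurable K
      (ae_of_all _ fun ω => hC _)) ?_
  filter_upwards [G.ae_law_mem_reachable SI SII hx k] with ω hω
  by_cases hb : (ω k).2 = false
  · rw [Set.indicator_of_mem (by exact hb)]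
    simp only [hf_def, hb]
    exact hψ.one_le _ (G.subset_thickened (hω.2 hb))
  · rw [Set.indicator_of_notMem (by exact hb)]
    exact hf0 _

lemma ae_law_exists_ended (hn : 2 ≤ n) (SI SII : G.Strategy) {x : E n} (hx : x ∈ G.thickened) :
    ∀ᵐ ω ∂(G.law SI SII x), ∃ k, (ω k).2 = true := by
  obtain ⟨ψ, K, hψ⟩ := G.exists_lyapunov hn
  rw [ae_iff, ← measureReal_eq_zero_iff]
  refine le_antisymm ?_ measureReal_nonneg
  have h1 : Tendsto (fun k => (1 - K⁻¹) ^ k * K) atTop (𝓝 0) := by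
    simpa using hψ.tendsto_rate_pow.mul_const K
  refine ge_of_tendsto' h1 fun k => le_trans ?_ (G.measureReal_not_ended_le SI SII hx hψ k)
  refine measureReal_mono fun ω hω => ?_
  simpa using not_exists.mp hω k

/-- A function of the state which agrees with `F` after the end of the game converges to the
payoff along almost every trajectory. -/
lemma ae_law_tendsto_payoff (hn : 2 ≤ n) (SI SII : G.Strategy) {x : E n} (hx : x ∈ G.thickened)
    {g : State n → ℝ} (hg : ∀ y ∈ G.strip, g (y, true) = G.F y) :
    ∀ᵐ ω ∂(G.law SI SII x), Tendsto (fun k => g (ω k)) atTop (𝓝 (G.payoff ω)) := by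
  filter_upwards [G.ae_law_exists_ended hn SI SII hx,
    ae_all_iff.mpr fun k => G.ae_law_mem_reachable SI SII hx k,
    ae_all_iff.mpr fun k => G.ae_law_succ_eq SI SII x k] with ω hend hreach hstay
  have hτ : (ω (endTime ω)).2 = true := Nat.sInf_mem hend
  have hfix : ∀ k ≥ endTime ω, ω k = ω (endTime ω) := by
    intro k hk
    induction k, hk using Nat.le_induction with
    | base => rfl
    | succ k _ ih => rw [hstay k (by rw [ih]; exact hτ), ih]
  refine tendsto_const_nhds.congr' ?_
  filter_upwards [eventually_ge_atTop (endTime ω)] with k hk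
  have h1 := hg _ ((hreach (endTime ω)).1 hτ)
  rw [hfix k hk, payoff, ← h1, ← hτ]

/-- Along almost every trajectory `g (ω k)` is eventually the payoff. This gives measurability of
the payoff as an almost sure limit, with no separate study of `endTime`, and dominated convergence
gives the rest. -/
lemma payoff_integrable_and_tendsto (hn : 2 ≤ n) (SI SII : G.Strategy) {x : E n}
    (hx : x ∈ G.thickened) {g : State n → ℝ} (hgm : Measurable g) {C : ℝ}
    (hC : ∀ s, |g s| ≤ C) (hg : ∀ y ∈ G.strip, g (y, true) = G.F y) :
    Integrable G.payoff (G.law SI SII x) ∧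
      Tendsto (fun k => ∫ ω, g (ω k) ∂(G.law SI SII x)) atTop
        (𝓝 (∫ ω, G.payoff ω ∂(G.law SI SII x))) := by
  have hlim := G.ae_law_tendsto_payoff hn SI SII hx hg
  have hm : ∀ k, AEStronglyMeasurable (fun ω : ℕ → State n => g (ω k)) (G.law SI SII x) :=
    fun k => (hgm.comp (measurable_state k)).aestronglyMeasurable
  refine ⟨?_, ?_⟩
  · refine Integrable.of_bound (aestronglyMeasurable_of_tendsto_ae atTop hm hlim) C ?_
    filter_upwards [hlim] with ω hω
    exact le_of_tendsto' hω.norm fun k => hC _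
  · exact tendsto_integral_of_dominated_convergence (fun _ => C) hm (integrable_const C)
      (fun k => ae_of_all _ fun ω => hC _) hlim

/-! ### A nearly optimal strategy of Player II -/

/-- The move is the first term of a dense sequence that comes within `η` of the infimum. For each
index the admissible positions form an open set, so the first index is a Borel function. -/
lemma exists_measurable_near_minimizer [Nonempty (Moves n G.ε)] {u : E n → ℝ}
    (hu : Continuous u) {C : ℝ} (hC : ∀ x, |u x| ≤ C) {η : ℝ} (hη : 0 < η) :
    ∃ σ : E n → Moves n G.ε, Measurable σ ∧ ∀ x, G.W u x (σ x) ≤ (⨅ v, G.W u x v) + η := by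
  classical
  have hW := G.continuous_W hu hC
  have hinf : Continuous fun x => ⨅ v, G.W u x v := by
    have h := (isCompact_univ (X := Moves n G.ε)).continuous_sInf (f := G.W u) hW
    simp only [Set.image_univ] at h
    exact h
  have hex : ∀ x, ∃ i, G.W u x (TopologicalSpace.denseSeq (Moves n G.ε) i)
      < (⨅ v, G.W u x v) + η := fun x => by
    obtain ⟨v, hv⟩ := exists_lt_of_ciInf_lt (lt_add_of_pos_right (⨅ v, G.W u x v) hη)
    have hopen : IsOpen {w | G.W u x w < (⨅ v, G.W u x v) + η} :=
      isOpen_lt (hW.comp (Continuous.prodMk_right x)) continuous_const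
    exact (TopologicalSpace.denseRange_denseSeq (Moves n G.ε)).exists_mem_open hopen ⟨v, hv⟩
  refine ⟨fun x => TopologicalSpace.denseSeq (Moves n G.ε) (Nat.find (hex x)), ?_,
    fun x => (Nat.find_spec (hex x)).le⟩
  refine (measurable_from_nat (f := TopologicalSpace.denseSeq (Moves n G.ε))).comp
    (measurable_find hex fun i => ?_)
  exact (isOpen_lt (hW.comp (Continuous.prodMk_left _))
    (hinf.add continuous_const)).measurableSet

/-- The strategy which moves by `σ x` whenever the token is at `x`. -/
def markovStrategy (σ : E n → Moves n G.ε) (hσ : Measurable σ) : G.Strategy :=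
  ⟨fun k h => σ (h ⟨k, Finset.mem_Iic.mpr le_rfl⟩),
    fun _ => hσ.comp (measurable_pi_apply _)⟩

/-- If `u` is nearly a supersolution of the dynamic programming principle, then Player II can
make sure that the expected payoff is not much larger than `I u`. -/
lemma valueII_le_dpp_add (hn : 2 ≤ n) {f u ψ : E n → ℝ} {C K η : ℝ} (hη : 0 < η)
    (hf : Continuous f) (hfC : ∀ y, |f y| ≤ C) (hfF : Set.EqOn G.F f G.strip)
    (hu : Continuous u) (huC : ∀ y, |u y| ≤ C) (hψ : G.Lyapunov ψ K)
    (hsuper : ∀ y ∈ G.thickened, G.dpp f u y ≤ u y + η) {x : E n} (hx : x ∈ G.thickened) :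
    G.valueII x ≤ ((G.dpp f u x + 2 * η * K : ℝ) : EReal) := by
  have := G.nonempty_moves hn
  obtain ⟨σ, hσ, hσu⟩ := G.exists_measurable_near_minimizer hu huC hη
  refine (iInf_le _ (G.markovStrategy σ hσ)).trans (iSup_le fun SI => ?_)
  rw [EReal.coe_le_coe_iff]
  -- Each turn `2 * η * ψ` drops by at least `2 * η` on average. This covers the `η` lost in
  -- `hsuper` and the `η / 2` lost when Player II wins the toss and plays a near minimizer.
  set V : State n → ℝ := fun s => if s.2 = true then f s.1 else G.mid u s.1 + 2 * η * ψ s.1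
    with hV_def
  have hmid := G.continuous_mid hu huC
  have hψc := hψ.continuous
  have hV : Measurable V := by
    refine Measurable.ite (measurable_snd (measurableSet_singleton true)) ?_ ?_
    · exact hf.measurable.comp measurable_fst
    · have hc : Continuous fun s : State n => G.mid u s.1 + 2 * η * ψ s.1 := by fun_prop
      exact hc.measurable
  have hmidC : ∀ y, |G.mid u y| ≤ C := fun y => by
    have h0 : 0 ≤ C := (abs_nonneg _).trans (huC y)
    have hCC : ∀ z : E n, |(fun _ => C) z| ≤ C := fun z => (abs_of_nonneg h0).le
    have hCn : ∀ z : E n, |(fun _ => -C) z| ≤ C := fun z => by simp [abs_of_nonneg h0]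
    have h1 := G.mid_le_mid_add hu continuous_const huC hCC (x := y) (a := 0) fun v => by
      rw [add_zero, G.W_const]; exact (abs_le.mp (G.abs_W_le hu huC y v)).2
    have h2 := G.mid_le_mid_add continuous_const hu hCn huC (x := y) (a := 0) fun v => by
      rw [add_zero, G.W_const]; exact (abs_le.mp (G.abs_W_le hu huC y v)).1
    rw [G.mid_const, add_zero] at h1 h2
    exact abs_le.mpr ⟨h2, h1⟩
  have hK : 0 ≤ K := zero_le_one.trans hψ.one_le_bound
  have hVC : ∀ s, |V s| ≤ C + 2 * η * K := fun s => by
    simp only [hV_def]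
    have h1 : |2 * η * ψ s.1| ≤ 2 * η * K := by
      rw [abs_of_nonneg (by have := hψ.nonneg s.1; positivity)]
      exact mul_le_mul_of_nonneg_left (hψ.le _) (by positivity)
    split_ifs
    · exact (hfC _).trans (le_add_of_nonneg_right (by positivity))
    · exact (abs_add_le _ _).trans (add_le_add (hmidC _) h1)
  -- The lottery weights `f` by `δ` and `mid u` by `1 - δ`, which rebuilds the dynamic programming
  -- operator.
  have hlot : G.lottery V = fun y => G.dpp f u y + (1 - G.δ y) * (2 * η * ψ y) := by
    funext y
    simp only [lottery, hV_def, dpp, if_true, Bool.false_eq_true, if_false]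
    ring
  have hlotc : Continuous (G.lottery V) := by
    have h1 := G.continuous_dpp hf hu huC
    have h2 := G.continuous_δ
    rw [hlot]
    fun_prop
  have hlot_le : ∀ y, G.lottery V y ≤ G.dpp f u y + 2 * η * ψ y := fun y => by
    rw [hlot]
    have h1 : 0 ≤ 2 * η * ψ y := mul_nonneg (by positivity) (hψ.nonneg y)
    have h2 := mul_nonneg (G.δ_nonneg y) h1
    simp only
    linarith
  have hWlot : ∀ y ∈ G.Ω, ∀ v, G.W (G.lottery V) y v ≤ G.W u y v + 2 * η * (ψ y - 1) + η := by
    intro y hy v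
    have h1 : G.W (G.lottery V) y v ≤ G.W (fun z => u z + 2 * η * ψ z + η) y v := by
      refine G.W_mono hlotc (by fun_prop) (fun z hz => ?_) v
      linarith [hlot_le (y + z), hsuper _ (G.add_mem_thickened hy hz)]
    rw [G.W_add_mul hu hψc] at h1
    have h2 := mul_le_mul_of_nonneg_left (hψ.W_le y hy v) (by positivity : 0 ≤ 2 * η)
    linarith
  set P := G.law SI (G.markovStrategy σ hσ) x
  have hdecr : ∀ k, ∫ ω, V (ω k) ∂P ≤ G.dpp f u x + 2 * η * K := by
    intro k
    induction k with
    | zero =>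
      rw [G.integral_law_zero SI _ x hV]
      exact (hlot_le x).trans (add_le_add_right
        (mul_le_mul_of_nonneg_left (hψ.le x) (by positivity)) _)
    | succ k ih =>
      refine le_trans ?_ ih
      have h := G.integral_law_succ_le SI (G.markovStrategy σ hσ) hx k hV hVC (c := 1)
        (fun y _ => by rw [one_mul]) fun h hΩ => ?_
      · rwa [one_mul] at h
      · have hII : (G.markovStrategy σ hσ).1 k (positions k h) = σ (last k h).1 := rfl
        have h1 := hWlot _ hΩ (SI.1 k (positions k h))
        have h2 := hWlot _ hΩ (σ (last k h).1)
        have h3 := hσu (last k h).1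
        have h4 := le_ciSup (G.bddAbove_W hu huC (last k h).1) (SI.1 k (positions k h))
        have h5 : V ((last k h).1, false) = G.mid u (last k h).1 + 2 * η * ψ (last k h).1 := by
          simp [hV_def]
        rw [hII, h5, mid]
        linarith
  have hlim := (G.payoff_integrable_and_tendsto hn SI (G.markovStrategy σ hσ) hx hV hVC
    fun y hy => by simp [hV_def, hfF hy]).2
  exact le_of_tendsto' hlim hdecr

end Setting

end TugOfWar

end

/-! ### Convergence of the iterates and the bound on the value -/

theorem mainTheorem5 {n : ℕ} (hn : 2 ≤ n) (G : TugOfWar.Setting n) :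
    (∀ x ∈ G.thickened, Tendsto (fun k => G.iter k x) atTop (𝓝 (G.lowerSol x))) ∧
    (∀ x ∈ G.thickened, ∀ SI SII : G.Strategy,
      (∀ᵐ ω ∂(G.law SI SII x), ∃ k, (ω k).2 = true) ∧
      Integrable G.payoff (G.law SI SII x)) ∧
    (∀ x ∈ G.thickened, G.valueII x ≤ (G.lowerSol x : EReal)) := by
  have := G.nonempty_moves hn
  obtain ⟨f, M, hf, hfF, hfm⟩ := G.exists_extension hn
  obtain ⟨ψ, K, hψ⟩ := G.exists_lyapunov hn
  set m := sInf (G.F '' G.strip) with hm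
  have hiter : ∀ k, ∀ x ∈ G.thickened, G.iter k x = ((G.dpp f)^[k] fun _ => m) x :=
    fun k x hx => G.iter_eq_dpp_iterate hfF k hx
  have hmono : ∀ x, Monotone fun k => ((G.dpp f)^[k] fun _ => m) x :=
    fun x => monotone_nat_of_le_succ fun k => G.dpp_iterate_le_succ hf hfm k x
  have hbdd : ∀ x, BddAbove (Set.range fun k => ((G.dpp f)^[k] fun _ => m) x) := fun x =>
    ⟨M, by rintro _ ⟨k, rfl⟩; exact ((G.dpp_iterate_regular hf hfm k).2 x).2⟩
  have hlim : ∀ x ∈ G.thickened,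
      Tendsto (fun k => G.iter k x) atTop (𝓝 (G.lowerSol x)) := fun x hx => by
    refine tendsto_nhds_limUnder ⟨⨆ k, ((G.dpp f)^[k] fun _ => m) x, ?_⟩
    simp only [hiter _ x hx]
    exact tendsto_atTop_ciSup (hmono x) (hbdd x)
  have hfC : ∀ y, |f y| ≤ max |m| |M| := fun y => abs_le_max_abs_abs (hfm y).1 (hfm y).2
  refine ⟨hlim, fun x hx SI SII => ⟨G.ae_law_exists_ended hn SI SII hx, ?_⟩, fun x hx => ?_⟩
  · exact (G.payoff_integrable_and_tendsto hn SI SII hx (g := fun s => f s.1)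
      (hf.measurable.comp measurable_fst) (fun s => hfC s.1) fun y hy => (hfF hy).symm).1
  · have hle : ∀ k, ((G.dpp f)^[k] fun _ => m) x ≤ G.lowerSol x := fun k => by
      have h := hlim x hx
      simp only [hiter _ x hx] at h
      exact (hmono x).ge_of_tendsto h k
    have hK : 0 < K := zero_lt_one.trans_le hψ.one_le_bound
    have hmM : 0 ≤ M - m := sub_nonneg.mpr ((hfm x).1.trans (hfm x).2)
    refine EReal.le_of_forall_lt_iff_le.mp fun c hc => ?_
    rw [EReal.coe_lt_coe_iff] at hc
    -- The total error `2 * η * K` then exactly fills the gap between `c` and the limit.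
    set η := (c - G.lowerSol x) / (2 * K) with hη_def
    have hη : 0 < η := div_pos (sub_pos.mpr hc) (by positivity)
    have hηK : 2 * η * K = c - G.lowerSol x := by
      rw [hη_def]
      field_simp
    have hrate : Tendsto (fun k => (M - m) * (1 - K⁻¹) ^ k * K) atTop (𝓝 0) := by
      simpa using (hψ.tendsto_rate_pow.const_mul (M - m)).mul_const K
    -- From here on the increment `u_{N+1} - u_N` is below `η` on all of `Ω_ε`, so `u_N` is nearly a
    -- supersolution.
    obtain ⟨N, hN⟩ := (hrate.eventually (gt_mem_nhds hη)).exists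
    have hreg := G.dpp_iterate_regular hf hfm N
    have hval := G.valueII_le_dpp_add hn hη hf hfC hfF hreg.1
      (fun y => abs_le_max_abs_abs (hreg.2 y).1 (hreg.2 y).2) hψ (fun y hy => ?_) hx
    · rw [← Function.iterate_succ_apply' (G.dpp f)] at hval
      refine hval.trans (EReal.coe_le_coe_iff.mpr ?_)
      linarith [hle (N + 1)]
    · rw [← Function.iterate_succ_apply' (G.dpp f)]
      have h1 := G.dpp_iterate_succ_le hf hfm hψ N hy
      have h2 := mul_le_mul_of_nonneg_left (hψ.le y)
        (mul_nonneg hmM (pow_nonneg hψ.rate_nonneg N))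
      linarith
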